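/- **Two-player LQG problem.** Fix a horizon $T\ge 0$. For $0\le t\le T-1$ consider $$x_{t+1}=A_tx_t+B_tu_t+w_t,\qquad y_t=C_tx_t+v_t,$$ where $x_t=(x^1_t,x^2_t)$, $u_t=(u^1_t,u^2_t)$, $y_t=(y^1_t,y^2_t)$ are real vectors and $A_t,B_t,C_t$ are block lower triangular, $$A_t=\begin{bmatrix}A_{11}&0\\A_{21}&A_{22}\end{bmatrix},\quad B_t=\begin{bmatrix}B_{11}&0\\B_{21}&B_{22}\end{bmatrix},\quad C_t=\begin{bmatrix}C_{11}&0\\C_{21}&C_{22}\end{bmatrix};$$ all matrices and dimensions may depend on $t$. The random vectors $x_0,(w_0,v_0),\dots,(w_{T-1},v_{T-1})$ are mutually independent and Gaussian with mean zero, with $\operatorname{Cov}(x_0)=\Sigma_{\rm init}$ and $\operatorname{Cov}(w_t,v_t)=\begin{bmatrix}W_t&U_t^{\mathsf T}\\U_t&V_t\end{bmatrix}$ (possibly singular). The information of Player 1 and of Player 2 at time $t$ is $$\hat{\mathbf i}_t=(y^1_{0:t-1},u^1_{0:t-1}),\qquad \mathbf i_t=(y_{0:t-1},u_{0:t-1}),$$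 and a pair of strategies is a pair of families of Borel functions $f^1=(f^1_t)$, $f^2=(f^2_t)$, $0\le t\le T-1$, with $u^1_t=f^1_t(\hat{\mathbf i}_t)$ and $u^2_t=f^2_t(\mathbf i_t)$. Its cost is $$J(f^1,f^2)=\mathbb E\Big[\sum_{t=0}^{T-1}\begin{bmatrix}x_t\\u_t\end{bmatrix}^{\mathsf T}\begin{bmatrix}Q_t&S_t\\S_t^{\mathsf T}&R_t\end{bmatrix}\begin{bmatrix}x_t\\u_t\end{bmatrix}+x_T^{\mathsf T}P_{\rm final}x_T\Big]\in[0,\infty],$$ where $\begin{bmatrix}Q_t&S_t\\S_t^{\mathsf T}&R_t\end{bmatrix}\succeq0$ for $0\le t\le T-1$ and $P_{\rm final}\succeq0$. For a pair of strategies let $$\hat z_t=\mathbb E[x_t\mid\hat{\mathbf i}_t],\qquad z_t=\mathbb E[x_t\mid\mathbf i_t]$$ be the conditional means in the resulting closed loop. Given deterministic matrices $G_t,H^1_t,H^2_t$, say that the pair has *the form* $(G,H^1,H^2)$ if, almost surely for all $0\le t\le T-1$, $$u^1_t=G_t\hat z_t,\qquad u^2_t=H^1_t\hat z_t+H^2_tz_t.$$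 **Theorem.** 1. There are deterministic matrices $G_t,H^1_t,H^2_t$ and a pair of strategies of the form $(G,H^1,H^2)$ whose controls have finite second moments and which minimizes $J$ over all pairs of strategies whose controls have finite second moments. 2. If moreover $R_t\succ0$ for all $0\le t\le T-1$, then there is a pair of strategies minimizing $J$ over all pairs of strategies, and there are deterministic matrices $G_t,H^1_t,H^2_t$ such that every such minimizing pair has controls with finite second moments and has the form $(G,H^1,H^2)$. -/

import Mathlib

open MeasureTheory ProbabilityTheory Matrix
open scoped ENNReal

/-- The data of a finite-horizon two-player LQG problem with block lower triangular dynamics.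
All matrices, and all dimensions, may vary with time; only times `0 ≤ t ≤ T` matter. -/
structure TwoPlayerLQG where
  /-- time horizon -/
  T : ℕ
  /-- dimensions of the two state blocks -/
  n₁ : ℕ → ℕ
  n₂ : ℕ → ℕ
  /-- dimensions of the two control blocks -/
  m₁ : ℕ → ℕ
  m₂ : ℕ → ℕ
  /-- dimensions of the two measurement blocks -/
  p₁ : ℕ → ℕ
  p₂ : ℕ → ℕ
  A₁₁ : ∀ t, Matrix (Fin (n₁ (t + 1))) (Fin (n₁ t)) ℝ
  A₂₁ : ∀ t, Matrix (Fin (n₂ (t + 1))) (Fin (n₁ t)) ℝ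
  A₂₂ : ∀ t, Matrix (Fin (n₂ (t + 1))) (Fin (n₂ t)) ℝ
  B₁₁ : ∀ t, Matrix (Fin (n₁ (t + 1))) (Fin (m₁ t)) ℝ
  B₂₁ : ∀ t, Matrix (Fin (n₂ (t + 1))) (Fin (m₁ t)) ℝ
  B₂₂ : ∀ t, Matrix (Fin (n₂ (t + 1))) (Fin (m₂ t)) ℝ
  C₁₁ : ∀ t, Matrix (Fin (p₁ t)) (Fin (n₁ t)) ℝ
  C₂₁ : ∀ t, Matrix (Fin (p₂ t)) (Fin (n₁ t)) ℝ
  C₂₂ : ∀ t, Matrix (Fin (p₂ t)) (Fin (n₂ t)) ℝ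
  /-- covariance of the initial state -/
  Sinit : Matrix (Fin (n₁ 0) ⊕ Fin (n₂ 0)) (Fin (n₁ 0) ⊕ Fin (n₂ 0)) ℝ
  /-- blocks of the covariance `[W Uᵀ; U V]` of the noise `(w t, v t)` -/
  W : ∀ t, Matrix (Fin (n₁ (t + 1)) ⊕ Fin (n₂ (t + 1))) (Fin (n₁ (t + 1)) ⊕ Fin (n₂ (t + 1))) ℝ
  U : ∀ t, Matrix (Fin (p₁ t) ⊕ Fin (p₂ t)) (Fin (n₁ (t + 1)) ⊕ Fin (n₂ (t + 1))) ℝ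
  V : ∀ t, Matrix (Fin (p₁ t) ⊕ Fin (p₂ t)) (Fin (p₁ t) ⊕ Fin (p₂ t)) ℝ
  /-- blocks of the stage cost matrix `[Q S; Sᵀ R]` -/
  Q : ∀ t, Matrix (Fin (n₁ t) ⊕ Fin (n₂ t)) (Fin (n₁ t) ⊕ Fin (n₂ t)) ℝ
  S : ∀ t, Matrix (Fin (n₁ t) ⊕ Fin (n₂ t)) (Fin (m₁ t) ⊕ Fin (m₂ t)) ℝ
  R : ∀ t, Matrix (Fin (m₁ t) ⊕ Fin (m₂ t)) (Fin (m₁ t) ⊕ Fin (m₂ t)) ℝ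
  /-- terminal cost matrix -/
  Pfinal : Matrix (Fin (n₁ T) ⊕ Fin (n₂ T)) (Fin (n₁ T) ⊕ Fin (n₂ T)) ℝ

namespace TwoPlayerLQG

/-- `ξ` is a Gaussian random vector with mean zero and covariance matrix `K`
(possibly degenerate). -/
structure IsCenteredGaussian {Ω ι : Type*} [MeasurableSpace Ω] [Fintype ι] (μ : Measure Ω)
    (ξ : Ω → ι → ℝ) (K : Matrix ι ι ℝ) : Prop where
  measurable : Measurable ξ
  gaussian : HasGaussianLaw ξ μ
  mean : ∀ i, ∫ ω, ξ ω i ∂μ = 0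
  cov : ∀ i j, covariance (fun ω => ξ ω i) (fun ω => ξ ω j) μ = K i j

variable (P : TwoPlayerLQG)

/-- State vectors `(x¹, x²)` at time `t`. -/
abbrev State (t : ℕ) : Type := Fin (P.n₁ t) ⊕ Fin (P.n₂ t) → ℝ

/-- Control vectors `(u¹, u²)` at time `t`. -/
abbrev Ctrl (t : ℕ) : Type := Fin (P.m₁ t) ⊕ Fin (P.m₂ t) → ℝ

/-- Measurement vectors `(y¹, y²)` at time `t`. -/
abbrev Meas (t : ℕ) : Type := Fin (P.p₁ t) ⊕ Fin (P.p₂ t) → ℝ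

/-- Block lower triangular state matrix. -/
abbrev A (t : ℕ) : Matrix (Fin (P.n₁ (t + 1)) ⊕ Fin (P.n₂ (t + 1)))
    (Fin (P.n₁ t) ⊕ Fin (P.n₂ t)) ℝ :=
  Matrix.fromBlocks (P.A₁₁ t) 0 (P.A₂₁ t) (P.A₂₂ t)

/-- Block lower triangular input matrix. -/
abbrev B (t : ℕ) : Matrix (Fin (P.n₁ (t + 1)) ⊕ Fin (P.n₂ (t + 1)))
    (Fin (P.m₁ t) ⊕ Fin (P.m₂ t)) ℝ :=
  Matrix.fromBlocks (P.B₁₁ t) 0 (P.B₂₁ t) (P.B₂₂ t)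

/-- Block lower triangular measurement matrix. -/
abbrev C (t : ℕ) : Matrix (Fin (P.p₁ t) ⊕ Fin (P.p₂ t))
    (Fin (P.n₁ t) ⊕ Fin (P.n₂ t)) ℝ :=
  Matrix.fromBlocks (P.C₁₁ t) 0 (P.C₂₁ t) (P.C₂₂ t)

/-- Stage cost matrix on `(x, u)`. -/
abbrev stageMatrix (t : ℕ) :
    Matrix ((Fin (P.n₁ t) ⊕ Fin (P.n₂ t)) ⊕ (Fin (P.m₁ t) ⊕ Fin (P.m₂ t)))
      ((Fin (P.n₁ t) ⊕ Fin (P.n₂ t)) ⊕ (Fin (P.m₁ t) ⊕ Fin (P.m₂ t))) ℝ :=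
  Matrix.fromBlocks (P.Q t) (P.S t) (P.S t)ᵀ (P.R t)

/-- Values of Player 1's information at time `t`: past measurements `y¹` and controls `u¹`. -/
abbrev Info₁ (t : ℕ) : Type :=
  ∀ s : Fin t, (Fin (P.p₁ s) → ℝ) × (Fin (P.m₁ s) → ℝ)

/-- Values of Player 2's information at time `t`: all past measurements and controls. -/
abbrev Info₂ (t : ℕ) : Type :=
  ∀ s : Fin t, P.Meas s × P.Ctrl s

/-- The part of Player 2's information that is known to Player 1. -/
def restrict {t : ℕ} (h : P.Info₂ t) : P.Info₁ t :=
  fun s => (fun i => (h s).1 (Sum.inl i), fun i => (h s).2 (Sum.inl i))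

/-- A pair of control strategies. -/
structure Strategy where
  f₁ : ∀ t, P.Info₁ t → Fin (P.m₁ t) → ℝ
  f₂ : ∀ t, P.Info₂ t → Fin (P.m₂ t) → ℝ

/-- The primitive random vectors: initial state, process noise and measurement noise. -/
structure Noise (Ω : Type*) where
  x₀ : Ω → P.State 0
  w : ∀ t, Ω → P.State (t + 1)
  v : ∀ t, Ω → P.Meas t

variable {P}
variable {Ω : Type*}

/-- The vectors `x₀, (w₀,v₀), …, (w_{T-1},v_{T-1})` are mutually independent, centered Gaussian,
with the covariances prescribed by the problem data. -/
structure Noise.IsValid [MeasurableSpace Ω] (N : P.Noise Ω) (μ : Measure Ω) : Prop where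
  init : IsCenteredGaussian μ N.x₀ P.Sinit
  noise : ∀ t < P.T, IsCenteredGaussian μ (fun ω => Sum.elim (N.w t ω) (N.v t ω))
    (Matrix.fromBlocks (P.W t) (P.U t)ᵀ (P.U t) (P.V t))
  indep : iIndep (fun o : Option (Fin P.T) => o.elim
    (MeasurableSpace.comap N.x₀ inferInstance)
    (fun t => MeasurableSpace.comap
      (fun ω => Sum.elim (N.w t ω) (N.v t ω)) inferInstance)) μ

/-- The measurement `y_t = C_t x + v_t`. -/
def measure (N : P.Noise Ω) (ω : Ω) (t : ℕ) (x : P.State t) : P.Meas t :=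
  P.C t *ᵥ x + N.v t ω

/-- The joint control vector chosen by the two players, given Player 2's information. -/
def act (f : P.Strategy) (t : ℕ) (h : P.Info₂ t) : P.Ctrl t :=
  Sum.elim (f.f₁ t (P.restrict h)) (f.f₂ t h)

/-- The closed loop: the state at time `t` together with the record of all measurements and
controls before time `t`. -/
def closedLoop (f : P.Strategy) (N : P.Noise Ω) (ω : Ω) : ∀ t, P.State t × P.Info₂ t
  | 0 => (N.x₀ ω, fun s => s.elim0)
  | t + 1 =>
    let x := (closedLoop f N ω t).1
    let h := (closedLoop f N ω t).2
    (P.A t *ᵥ x + P.B t *ᵥ act f t h + N.w t ω,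
      Fin.snoc (α := fun s : Fin (t + 1) => P.Meas s × P.Ctrl s) h
        (measure N ω t x, act f t h))

/-- The state process. -/
def x (f : P.Strategy) (N : P.Noise Ω) (t : ℕ) (ω : Ω) : P.State t :=
  (closedLoop f N ω t).1

/-- Player 2's information `i_t`. -/
def info₂ (f : P.Strategy) (N : P.Noise Ω) (t : ℕ) (ω : Ω) : P.Info₂ t :=
  (closedLoop f N ω t).2

/-- Player 1's information `î_t`. -/
def info₁ (f : P.Strategy) (N : P.Noise Ω) (t : ℕ) (ω : Ω) : P.Info₁ t :=
  P.restrict (info₂ f N t ω)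

/-- The measurement process. -/
def y (f : P.Strategy) (N : P.Noise Ω) (t : ℕ) (ω : Ω) : P.Meas t :=
  P.C t *ᵥ x f N t ω + N.v t ω

/-- Player 1's control process. -/
def u₁ (f : P.Strategy) (N : P.Noise Ω) (t : ℕ) (ω : Ω) : Fin (P.m₁ t) → ℝ :=
  f.f₁ t (info₁ f N t ω)

/-- Player 2's control process. -/
def u₂ (f : P.Strategy) (N : P.Noise Ω) (t : ℕ) (ω : Ω) : Fin (P.m₂ t) → ℝ :=
  f.f₂ t (info₂ f N t ω)

/-- The joint control process. -/
def u (f : P.Strategy) (N : P.Noise Ω) (t : ℕ) (ω : Ω) : P.Ctrl t :=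
  Sum.elim (u₁ f N t ω) (u₂ f N t ω)

/-- The closed-loop processes satisfy the state equation. -/
theorem x_succ (f : P.Strategy) (N : P.Noise Ω) (t : ℕ) (ω : Ω) :
    x f N (t + 1) ω = P.A t *ᵥ x f N t ω + P.B t *ᵥ u f N t ω + N.w t ω := rfl

/-- Player 2's information is the record of the measurement and control processes. -/
theorem info₂_apply (f : P.Strategy) (N : P.Noise Ω) (t : ℕ) (ω : Ω) (s : Fin t) :
    info₂ f N t ω s = (y f N s ω, u f N s ω) := by
  induction t with
  | zero => exact s.elim0
  | succ t ih =>
    refine Fin.lastCases ?_ (fun s => ?_) s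
    · exact Fin.snoc_last (α := fun s : Fin (t + 1) => P.Meas s × P.Ctrl s) _ _
    · exact (Fin.snoc_castSucc (α := fun s : Fin (t + 1) => P.Meas s × P.Ctrl s) _ _ s).trans
        (ih s)

/-- Borel measurable strategies. -/
def Strategy.IsMeasurable (f : P.Strategy) : Prop :=
  ∀ t < P.T, Measurable (f.f₁ t) ∧ Measurable (f.f₂ t)

/-- All controls have finite second moments. -/
def FiniteSecondMoments [MeasurableSpace Ω] (f : P.Strategy) (N : P.Noise Ω)
    (μ : Measure Ω) : Prop :=
  ∀ t < P.T, MemLp (u f N t) 2 μ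

/-- The quadratic cost along a trajectory. -/
noncomputable def pathCost (f : P.Strategy) (N : P.Noise Ω) (ω : Ω) : ℝ :=
  (∑ t ∈ Finset.range P.T,
    Sum.elim (x f N t ω) (u f N t ω) ⬝ᵥ
      (P.stageMatrix t *ᵥ Sum.elim (x f N t ω) (u f N t ω)))
    + x f N P.T ω ⬝ᵥ (P.Pfinal *ᵥ x f N P.T ω)

/-- The expected cost, as an extended nonnegative number. It is used only for positive
semidefinite cost matrices, where the cost along each trajectory is nonnegative. -/
noncomputable def cost [MeasurableSpace Ω] (f : P.Strategy) (N : P.Noise Ω)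
    (μ : Measure Ω) : ℝ≥0∞ :=
  ∫⁻ ω, ENNReal.ofReal (pathCost f N ω) ∂μ

/-- `f` minimizes the expected cost over all pairs of measurable strategies. -/
def IsOptimal [MeasurableSpace Ω] (f : P.Strategy) (N : P.Noise Ω) (μ : Measure Ω) : Prop :=
  f.IsMeasurable ∧ ∀ g : P.Strategy, g.IsMeasurable → cost f N μ ≤ cost g N μ

/-- `f` has finite second moments and minimizes the expected cost over all pairs of measurable
strategies with finite second moments. -/
def IsOptimalL2 [MeasurableSpace Ω] (f : P.Strategy) (N : P.Noise Ω) (μ : Measure Ω) : Prop :=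
  f.IsMeasurable ∧ FiniteSecondMoments f N μ ∧
    ∀ g : P.Strategy, g.IsMeasurable → FiniteSecondMoments g N μ → cost f N μ ≤ cost g N μ

/-- Player 1's estimate `ẑ_t = E[x_t | î_t]` in the closed loop of `f`. -/
noncomputable def zhat [MeasurableSpace Ω] (f : P.Strategy) (N : P.Noise Ω) (μ : Measure Ω)
    (t : ℕ) : Ω → P.State t :=
  condExp (MeasurableSpace.comap (info₁ f N t) inferInstance) μ (x f N t)

/-- Player 2's estimate `z_t = E[x_t | i_t]` in the closed loop of `f`. -/
noncomputable def z [MeasurableSpace Ω] (f : P.Strategy) (N : P.Noise Ω) (μ : Measure Ω)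
    (t : ℕ) : Ω → P.State t :=
  condExp (MeasurableSpace.comap (info₂ f N t) inferInstance) μ (x f N t)

/-- Almost surely, `u¹_t = G_t ẑ_t` and `u²_t = H¹_t ẑ_t + H²_t z_t` for `0 ≤ t < T`. -/
def HasForm [MeasurableSpace Ω] (f : P.Strategy) (N : P.Noise Ω) (μ : Measure Ω)
    (G : ∀ t, Matrix (Fin (P.m₁ t)) (Fin (P.n₁ t) ⊕ Fin (P.n₂ t)) ℝ)
    (H₁ H₂ : ∀ t, Matrix (Fin (P.m₂ t)) (Fin (P.n₁ t) ⊕ Fin (P.n₂ t)) ℝ) : Prop :=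
  ∀ t < P.T, ∀ᵐ ω ∂μ,
    u₁ f N t ω = G t *ᵥ zhat f N μ t ω ∧
    u₂ f N t ω = H₁ t *ᵥ zhat f N μ t ω + H₂ t *ᵥ z f N μ t ω

end TwoPlayerLQG

/-! Recorded controls enter the measurements linearly and can be subtracted, so each player's
information generates the same σ-algebra as that player's uncontrolled measurements (`comap_info₁`,
`comap_info₂`). For Player 1 this uses the triangular blocks. Hence no control changes what is
learned, and the problem moves to `L²`: controls are tuples of vectors, `G t ≤ F t` are the
finite-dimensional spans of the uncontrolled measurements known to Players 1 and 2, and the cost is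
a positive semidefinite quadratic form `costB`.

In a Gaussian space orthogonality is independence, so even a nonlinear function of the information
is orthogonal to all noise orthogonal to that information. Projecting the controls onto `G t` and `F
t` therefore does not increase the cost (`IsAdm.exists_isLin_le`), and among the linear controls
that remain a minimizer exists by finite dimension (`exists_optimal_lin`).

The main step replaces a linear control by constant gains on the current estimates. Split the
control into its part in `G t` and the rest, regress the first on Player 1's estimate and the second
on the gap between the two estimates, and run the loop again with these gains but without the
remainders `r` and `q`. The first block of the gap does not depend on the control (`IsLin.gap_inl`)
and `q` is orthogonal to the gap, so Player 1's next measurement carries no trace of `q`. By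
induction the difference of the two gaps stays uncorrelated with that first block
(`Regression.inner_gap_sub`), so Player 1's estimate receives the same correction in both loops.
What is dropped is then orthogonal to what is kept, and every linear functional of state and control
loses variance (`Regression.comb_stage_le`); so the cost does not increase.

If `R t` is positive definite, finite cost forces square integrable controls and the optimal control
is unique in `L²` (`eq_of_optimal`), so all optimal pairs share the same gains. -/

/-! ### Tuples of vectors in a Hilbert space: matrices, projections, regression, quadratic forms. -/

section Hilbert

variable {H : Type*} [NormedAddCommGroup H] [InnerProductSpace ℝ H]
variable {ι κ l : Type*} [Fintype ι]

/-- The linear combination of a tuple of vectors with given coefficients. -/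
def comb (c : ι → ℝ) : (ι → H) →ₗ[ℝ] H where
  toFun X := ∑ i, c i • X i
  map_add' X Y := by simp [Finset.sum_add_distrib]
  map_smul' a X := by simp [Finset.smul_sum, smul_comm a]

/-- A matrix acting on a tuple of vectors. -/
def matAct (M : Matrix κ ι ℝ) : (ι → H) →ₗ[ℝ] (κ → H) :=
  LinearMap.pi fun k => comb (M k)

/-- The orthogonal projection applied to each entry of a tuple. -/
noncomputable def projT {ι : Type*} (S : Submodule ℝ H) [S.HasOrthogonalProjection] :
    (ι → H) →ₗ[ℝ] (ι → H) :=
  LinearMap.pi fun i => S.starProjection.toLinearMap ∘ₗ LinearMap.proj i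

lemma comb_apply (c : ι → ℝ) (X : ι → H) : comb c X = ∑ i, c i • X i := rfl

lemma matAct_apply (M : Matrix κ ι ℝ) (X : ι → H) (k : κ) :
    matAct M X k = ∑ i, M k i • X i := rfl

lemma projT_apply {ι : Type*} (S : Submodule ℝ H) [S.HasOrthogonalProjection] (X : ι → H) (i : ι) :
    projT S X i = S.starProjection (X i) := rfl

lemma comb_mem {S : Submodule ℝ H} (c : ι → ℝ) {X : ι → H} (h : ∀ i, X i ∈ S) :
    comb c X ∈ S :=
  S.sum_mem fun i _ => S.smul_mem _ (h i)

lemma matAct_mem {S : Submodule ℝ H} (M : Matrix κ ι ℝ) {X : ι → H} (h : ∀ i, X i ∈ S) (k : κ) :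
    matAct M X k ∈ S := comb_mem _ h

lemma comb_mem_span (c : ι → ℝ) (X : ι → H) : comb c X ∈ Submodule.span ℝ (Set.range X) :=
  comb_mem c fun i => Submodule.subset_span (Set.mem_range_self i)

lemma comb_zero_left (X : ι → H) : comb 0 X = 0 := by
  simp [comb_apply]

lemma comb_matAct [Fintype κ] (c : κ → ℝ) (M : Matrix κ ι ℝ) (X : ι → H) :
    comb c (matAct M X) = comb (c ᵥ* M) X := by
  simp only [comb_apply, matAct_apply, Finset.smul_sum, vecMul, dotProduct, Finset.sum_smul,
    smul_smul]
  rw [Finset.sum_comm]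

lemma comb_add_left (c d : ι → ℝ) (X : ι → H) : comb (c + d) X = comb c X + comb d X := by
  simp [comb_apply, add_smul, Finset.sum_add_distrib]

lemma comb_sumElim [Fintype κ] (c : ι ⊕ κ → ℝ) (X : ι → H) (Y : κ → H) :
    comb c (Sum.elim X Y) = comb (c ∘ Sum.inl) X + comb (c ∘ Sum.inr) Y := by
  simp [comb_apply]

lemma matAct_add_left (M N : Matrix κ ι ℝ) (X : ι → H) :
    matAct (M + N) X = matAct M X + matAct N X := by
  ext k
  simp [matAct_apply, add_smul, Finset.sum_add_distrib]

lemma matAct_sub_left (M N : Matrix κ ι ℝ) (X : ι → H) :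
    matAct (M - N) X = matAct M X - matAct N X := by
  ext k
  simp [matAct_apply, sub_smul, Finset.sum_sub_distrib]

lemma matAct_matAct [Fintype κ] (M : Matrix l κ ℝ) (N : Matrix κ ι ℝ) (X : ι → H) :
    matAct M (matAct N X) = matAct (M * N) X := by
  ext k
  exact comb_matAct (M k) N X

lemma matAct_mem_span (M : Matrix κ ι ℝ) (X : ι → H) (k : κ) :
    matAct M X k ∈ Submodule.span ℝ (Set.range X) := comb_mem_span _ _

lemma matAct_one [DecidableEq ι] (X : ι → H) : matAct (1 : Matrix ι ι ℝ) X = X := by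
  ext k
  simp [matAct_apply, Matrix.one_apply]

section proj
variable (S : Submodule ℝ H) [S.HasOrthogonalProjection]

lemma comb_projT (c : ι → ℝ) (X : ι → H) :
    comb c (projT S X) = S.starProjection (comb c X) := by
  simp [comb_apply, projT_apply, map_sum]

lemma projT_mem {ι : Type*} (X : ι → H) (i : ι) : projT S X i ∈ S :=
  Submodule.starProjection_apply_mem _ _

lemma projT_of_mem {ι : Type*} {X : ι → H} (h : ∀ i, X i ∈ S) : projT S X = X := by
  ext i
  exact Submodule.starProjection_eq_self_iff.2 (h i)

lemma sub_projT_mem {ι : Type*} (X : ι → H) (i : ι) : X i - projT S X i ∈ Sᗮ :=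
  Submodule.sub_starProjection_mem_orthogonal _

lemma projT_of_mem_orthogonal {ι : Type*} {X : ι → H} (h : ∀ i, X i ∈ Sᗮ) : projT S X = 0 := by
  ext i
  exact (Submodule.starProjection_apply_eq_zero_iff S).2 (h i)

lemma projT_projT {ι : Type*} {S' : Submodule ℝ H} [S'.HasOrthogonalProjection] (h : S ≤ S') (X : ι → H) :
    projT S (projT S' X) = projT S X := by
  have h1 : projT S (X - projT S' X) = 0 :=
    projT_of_mem_orthogonal S fun i =>
      Submodule.orthogonal_le h (sub_projT_mem S' X i)
  rw [map_sub, sub_eq_zero] at h1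
  exact h1.symm

end proj

lemma norm_add_sq_of_mem {S : Submodule ℝ H} {a b : H} (ha : a ∈ S) (hb : b ∈ Sᗮ) :
    ‖a + b‖ ^ 2 = ‖a‖ ^ 2 + ‖b‖ ^ 2 := by
  rw [norm_add_sq_real, S.inner_right_of_mem_orthogonal ha hb]
  ring

lemma mem_orthogonal_span_range {ι : Type*} {X : ι → H} {h : H}
    (hX : ∀ i, inner ℝ h (X i) = 0) : h ∈ (Submodule.span ℝ (Set.range X))ᗮ := by
  rw [Submodule.mem_orthogonal']
  intro y hy
  induction hy using Submodule.span_induction with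
  | mem y hy => obtain ⟨i, rfl⟩ := hy; exact hX i
  | zero => exact inner_zero_right _
  | add a b _ _ ha hb => rw [inner_add_right, ha, hb, add_zero]
  | smul c a _ ha => rw [inner_smul_right, ha, mul_zero]

/-- Regression of a tuple of vectors on another tuple. -/
lemma exists_regression (X : ι → H) (Y : κ → H) :
    ∃ K : Matrix κ ι ℝ, ∀ k, Y k - matAct K X k ∈ (Submodule.span ℝ (Set.range X))ᗮ := by
  have := FiniteDimensional.span_of_finite ℝ (Set.finite_range X)
  have h : ∀ k, ∃ c : ι → ℝ, ∑ i, c i • X i =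
      (Submodule.span ℝ (Set.range X)).starProjection (Y k) := fun k =>
    (Submodule.mem_span_range_iff_exists_fun ℝ).1 (Submodule.starProjection_apply_mem _ _)
  choose K hK using h
  refine ⟨Matrix.of K, fun k => ?_⟩
  rw [matAct_apply]
  simp only [Matrix.of_apply, hK]
  exact Submodule.sub_starProjection_mem_orthogonal _

/-- The bilinear form on tuples of vectors given by a matrix. -/
noncomputable def quadB (M : Matrix ι ι ℝ) : (ι → H) →ₗ[ℝ] (ι → H) →ₗ[ℝ] ℝ :=
  LinearMap.mk₂ ℝ (fun X Y => ∑ i, ∑ j, M i j * inner ℝ (X i) (Y j))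
    (fun X Y Z => by simp [inner_add_left, mul_add, Finset.sum_add_distrib])
    (fun c X Y => by simp [inner_smul_left, Finset.mul_sum, mul_left_comm])
    (fun X Y Z => by simp [inner_add_right, mul_add, Finset.sum_add_distrib])
    (fun c X Y => by simp [inner_smul_right, Finset.mul_sum, mul_left_comm])

lemma quadB_apply (M : Matrix ι ι ℝ) (X Y : ι → H) :
    quadB M X Y = ∑ i, ∑ j, M i j * inner ℝ (X i) (Y j) := rfl

-- Factoring the matrix turns its form into a sum of squared norms of linear combinations, so
-- comparing costs reduces to comparing such norms.
open scoped MatrixOrder Matrix.Norms.L2Operator in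
lemma exists_quadB_eq {M : Matrix ι ι ℝ} (hM : M.PosSemidef) :
    ∃ L : Matrix ι ι ℝ, M = Lᵀ * L ∧ ∀ X Y : ι → H, quadB M X Y =
      ∑ k, inner ℝ (comb (L k) X) (comb (L k) Y) := by
  classical
  obtain ⟨L, hL⟩ := CStarAlgebra.nonneg_iff_eq_star_mul_self.mp (Matrix.nonneg_iff_posSemidef.2 hM)
  refine ⟨L, by simpa [star_eq_conjTranspose] using hL, fun X Y => ?_⟩
  subst hL
  simp only [quadB_apply, comb_apply, sum_inner, inner_sum, inner_smul_left, inner_smul_right,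
    star_eq_conjTranspose, mul_apply, conjTranspose_apply, Finset.sum_mul, star_trivial,
    conj_trivial, mul_assoc]
  rw [Finset.sum_comm]
  refine (Finset.sum_congr rfl fun j _ => Finset.sum_comm).trans ?_
  rw [Finset.sum_comm]
  refine Finset.sum_congr rfl fun k _ => ?_
  refine Finset.sum_congr rfl fun i _ => ?_
  rw [Finset.mul_sum]
  refine Finset.sum_congr rfl fun j _ => ?_
  ring

lemma quadB_comm {M : Matrix ι ι ℝ} (hM : M.PosSemidef) (X Y : ι → H) :
    quadB M X Y = quadB M Y X := by
  obtain ⟨L, -, hL⟩ := exists_quadB_eq (H := H) hM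
  simp [hL, real_inner_comm]

lemma quadB_nonneg {M : Matrix ι ι ℝ} (hM : M.PosSemidef) (X : ι → H) : 0 ≤ quadB M X X := by
  obtain ⟨L, -, hL⟩ := exists_quadB_eq (H := H) hM
  rw [hL]
  exact Finset.sum_nonneg fun k _ => real_inner_self_nonneg

/-- If every linear combination of `X` is at most as long as that of `Y`, then so are
the values of positive semidefinite forms. -/
lemma quadB_le {M : Matrix ι ι ℝ} (hM : M.PosSemidef) {X Y : ι → H}
    (h : ∀ c : ι → ℝ, ‖comb c X‖ ^ 2 ≤ ‖comb c Y‖ ^ 2) : quadB M X X ≤ quadB M Y Y := by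
  obtain ⟨L, -, hL⟩ := exists_quadB_eq (H := H) hM
  simp only [hL, real_inner_self_eq_norm_sq]
  exact Finset.sum_le_sum fun k _ => h _

/-- A positive semidefinite quadratic function on a finite-dimensional space has a minimizer. -/
lemma exists_minimizer {D V : Type*} [AddCommGroup D] [Module ℝ D] [AddCommGroup V] [Module ℝ V]
    [FiniteDimensional ℝ V] (B : LinearMap.BilinForm ℝ D) (hs : ∀ x y, B x y = B y x)
    (hn : ∀ x, 0 ≤ B x x) (j : V →ₗ[ℝ] D) (a : D) :
    ∃ v₀, ∀ v, B (a + j v₀) (a + j v₀) ≤ B (a + j v) (a + j v) := by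
  let T : V →ₗ[ℝ] Module.Dual ℝ V := B.compl₁₂ j j
  have hT : ∀ v w, T v w = B (j v) (j w) := fun _ _ => rfl
  let φ : Module.Dual ℝ V := B a ∘ₗ j
  -- By Cauchy–Schwarz `φ` vanishes on the radical of the pulled-back form. Hence the normal
  -- equations `B (j v₁) (j w) = B a (j w)` are solvable even when the form is degenerate.
  have hφ : φ ∈ LinearMap.range T.dualMap := by
    rw [LinearMap.range_dualMap_eq_dualAnnihilator_ker, Submodule.mem_dualAnnihilator]
    intro w hw
    have h0 : B (j w) (j w) = 0 := by
      rw [← hT, LinearMap.mem_ker.1 hw]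
      rfl
    have h1 := LinearMap.BilinForm.apply_mul_apply_le_of_forall_zero_le B hn a (j w)
    rw [h0, mul_zero, hs (j w) a] at h1
    exact mul_self_eq_zero.1 (le_antisymm h1 (mul_self_nonneg _))
  obtain ⟨ψ, hψ⟩ := hφ
  obtain ⟨v₁, rfl⟩ := (Module.evalEquiv ℝ V).surjective ψ
  have key : ∀ w, B (j v₁) (j w) = B a (j w) := fun w => by
    have := LinearMap.congr_fun hψ w
    rw [LinearMap.dualMap_apply, Module.evalEquiv_apply, Module.Dual.eval_apply, hT, hs] at this
    exact this
  refine ⟨-v₁, fun v => ?_⟩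
  have e : a + j v = (a + j (-v₁)) + j (v + v₁) := by
    simp only [map_add, map_neg]
    abel
  have h2 : B (a + j (-v₁)) (j (v + v₁)) = 0 := by
    rw [map_neg, map_add B, map_neg B, LinearMap.add_apply, LinearMap.neg_apply, key]
    ring
  have h3 := hs (j (v + v₁)) (a + j (-v₁))
  have h4 := hn (j (v + v₁))
  generalize a + j (-v₁) = p at *
  generalize j (v + v₁) = q at *
  rw [e, map_add B, LinearMap.add_apply, map_add, map_add, h3, h2]
  linarith

end Hilbert

section Blocks

variable {H : Type*} [NormedAddCommGroup H] [InnerProductSpace ℝ H]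
variable {ι₁ ι₂ κ₁ κ₂ : Type*} [Fintype ι₁] [Fintype ι₂]

lemma matAct_fromBlocks_inl (a : Matrix κ₁ ι₁ ℝ) (c : Matrix κ₂ ι₁ ℝ) (d : Matrix κ₂ ι₂ ℝ)
    (X : ι₁ ⊕ ι₂ → H) (k : κ₁) :
    matAct (fromBlocks a 0 c d) X (Sum.inl k) = matAct a (X ∘ Sum.inl) k := by
  simp [matAct_apply]

lemma matAct_fromBlocks_inl_mem {S : Submodule ℝ H} (a : Matrix κ₁ ι₁ ℝ) (c : Matrix κ₂ ι₁ ℝ)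
    (d : Matrix κ₂ ι₂ ℝ) {X : ι₁ ⊕ ι₂ → H} (h : ∀ i, X (Sum.inl i) ∈ S) (k : κ₁) :
    matAct (fromBlocks a 0 c d) X (Sum.inl k) ∈ S := by
  rw [matAct_fromBlocks_inl]
  exact matAct_mem a h k

end Blocks

/-! ### State equation and cost over an abstract Hilbert space. -/

namespace TwoPlayerLQG

/-- Index types of states, controls and measurements. -/
abbrev StateIdx (P : TwoPlayerLQG) (t : ℕ) : Type := Fin (P.n₁ t) ⊕ Fin (P.n₂ t)

abbrev CtrlIdx (P : TwoPlayerLQG) (t : ℕ) : Type := Fin (P.m₁ t) ⊕ Fin (P.m₂ t)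

abbrev MeasIdx (P : TwoPlayerLQG) (t : ℕ) : Type := Fin (P.p₁ t) ⊕ Fin (P.p₂ t)

/-- Control processes with values in a vector space `H` of random variables. -/
abbrev Policy (P : TwoPlayerLQG) (H : Type*) : Type _ := ∀ t, P.CtrlIdx t → H

/-- Initial state, process noise and control: everything that drives the state equation. -/
abbrev Drive (P : TwoPlayerLQG) (H : Type*) : Type _ :=
  (P.StateIdx 0 → H) × (∀ t, P.StateIdx (t + 1) → H) × P.Policy H

/-- The primitive random vectors with entries in a vector space `H` of random variables. -/
structure LinNoise (P : TwoPlayerLQG) (H : Type*) where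
  x₀ : P.StateIdx 0 → H
  w : ∀ t, P.StateIdx (t + 1) → H
  v : ∀ t, P.MeasIdx t → H

variable {P : TwoPlayerLQG} {H : Type*} [NormedAddCommGroup H] [InnerProductSpace ℝ H]

/-- The solution of the state equation. -/
def solve : ∀ t, P.Drive H →ₗ[ℝ] (P.StateIdx t → H)
  | 0 => LinearMap.fst ℝ _ _
  | t + 1 => matAct (P.A t) ∘ₗ solve t
      + matAct (P.B t) ∘ₗ LinearMap.proj t ∘ₗ LinearMap.snd ℝ _ _ ∘ₗ LinearMap.snd ℝ _ _
      + LinearMap.proj t ∘ₗ LinearMap.fst ℝ _ _ ∘ₗ LinearMap.snd ℝ _ _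

lemma solve_succ (t : ℕ) (d : P.Drive H) :
    solve (t + 1) d = matAct (P.A t) (solve t d) + matAct (P.B t) (d.2.2 t) + d.2.1 t := rfl

/-- State and control at time `t`. -/
def stage (t : ℕ) : P.Drive H →ₗ[ℝ] (P.StateIdx t ⊕ P.CtrlIdx t → H) where
  toFun d := Sum.elim (solve t d) (d.2.2 t)
  map_add' d d' := by ext (i | i) <;> simp
  map_smul' c d := by ext (i | i) <;> simp

lemma stage_apply (t : ℕ) (d : P.Drive H) : stage t d = Sum.elim (solve t d) (d.2.2 t) := rfl

/-- The expected cost as a bilinear form in the driving processes. -/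
noncomputable def costB : LinearMap.BilinForm ℝ (P.Drive H) :=
  ∑ t ∈ Finset.range P.T, (quadB (P.stageMatrix t)).compl₁₂ (stage t) (stage t)
    + (quadB P.Pfinal).compl₁₂ (solve P.T) (solve P.T)

lemma costB_apply (d d' : P.Drive H) :
    costB d d' = ∑ t ∈ Finset.range P.T, quadB (P.stageMatrix t) (stage t d) (stage t d')
      + quadB P.Pfinal (solve P.T d) (solve P.T d') := by
  simp [costB, LinearMap.sum_apply]

section PosSemidef

variable (hcost : ∀ t < P.T, (P.stageMatrix t).PosSemidef) (hfinal : P.Pfinal.PosSemidef)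
include hcost hfinal

lemma costB_comm (d d' : P.Drive H) : costB d d' = costB d' d := by
  rw [costB_apply, costB_apply, quadB_comm hfinal]
  congr 1
  exact Finset.sum_congr rfl fun t ht => quadB_comm (hcost t (Finset.mem_range.1 ht)) _ _

lemma costB_nonneg (d : P.Drive H) : 0 ≤ costB d d := by
  rw [costB_apply]
  exact add_nonneg (Finset.sum_nonneg fun t ht =>
    quadB_nonneg (hcost t (Finset.mem_range.1 ht)) _) (quadB_nonneg hfinal _)

end PosSemidef

lemma solve_congr {d d' : P.Drive H} (h₀ : d.1 = d'.1) {t : ℕ}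
    (hw : ∀ s < t, d.2.1 s = d'.2.1 s) (hu : ∀ s < t, d.2.2 s = d'.2.2 s) :
    solve t d = solve t d' := by
  induction t with
  | zero => exact h₀
  | succ t ih =>
    rw [solve_succ, solve_succ, hw t t.lt_succ_self, hu t t.lt_succ_self,
      ih (fun s hs => hw s (hs.trans t.lt_succ_self)) fun s hs => hu s (hs.trans t.lt_succ_self)]

/-- Processes are indexed by all natural numbers; this allows their values from the horizon on to be
changed freely. -/
lemma costB_congr {d d' : P.Drive H} (h₀ : d.1 = d'.1)
    (hw : ∀ s < P.T, d.2.1 s = d'.2.1 s) (hu : ∀ s < P.T, d.2.2 s = d'.2.2 s) :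
    costB d d = costB d' d' := by
  have h : ∀ t ≤ P.T, solve t d = solve t d' := fun t ht =>
    solve_congr h₀ (fun s hs => hw s (hs.trans_le ht)) fun s hs => hu s (hs.trans_le ht)
  rw [costB_apply, costB_apply, h _ le_rfl]
  congr 1
  refine Finset.sum_congr rfl fun t ht => ?_
  have ht := Finset.mem_range.1 ht
  rw [stage_apply, stage_apply, h t ht.le, hu t ht]

/-! ### Information spaces, estimates, gap and innovation. -/

namespace LinNoise

variable (N : P.LinNoise H)

/-- The span of the initial state and of the noise before time `t`. -/
def past : ℕ → Submodule ℝ H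
  | 0 => Submodule.span ℝ (Set.range N.x₀)
  | t + 1 => past t ⊔ Submodule.span ℝ (Set.range (N.w t)) ⊔ Submodule.span ℝ (Set.range (N.v t))

/-- The noise at each time is uncorrelated with the past. -/
def IsWhite : Prop :=
  ∀ t, (∀ i, N.w t i ∈ (N.past t)ᗮ) ∧ ∀ i, N.v t i ∈ (N.past t)ᗮ

/-- The state process under the control process `u`. -/
def state (u : P.Policy H) (t : ℕ) : P.StateIdx t → H := solve t (N.x₀, N.w, u)

/-- The measurement process without control. -/
def ybar (t : ℕ) : P.MeasIdx t → H := matAct (P.C t) (N.state 0 t) + N.v t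

/-- The span of Player 1's uncontrolled measurements before time `t`. -/
def G (t : ℕ) : Submodule ℝ H :=
  Submodule.span ℝ (Set.range fun k : (s : Fin t) × Fin (P.p₁ s) => N.ybar k.1 (Sum.inl k.2))

/-- The span of all uncontrolled measurements before time `t`. -/
def F (t : ℕ) : Submodule ℝ H :=
  Submodule.span ℝ (Set.range fun k : (s : Fin t) × P.MeasIdx s => N.ybar k.1 k.2)

instance (t : ℕ) : FiniteDimensional ℝ (N.G t) :=
  FiniteDimensional.span_of_finite ℝ (Set.finite_range _)

instance (t : ℕ) : FiniteDimensional ℝ (N.F t) :=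
  FiniteDimensional.span_of_finite ℝ (Set.finite_range _)

lemma ybar_mem_F {s t : ℕ} (h : s < t) (i) : N.ybar s i ∈ N.F t :=
  Submodule.subset_span ⟨⟨⟨s, h⟩, i⟩, rfl⟩

lemma ybar_mem_G {s t : ℕ} (h : s < t) (i) : N.ybar s (Sum.inl i) ∈ N.G t :=
  Submodule.subset_span ⟨⟨⟨s, h⟩, i⟩, rfl⟩

lemma G_le_succ (t : ℕ) : N.G t ≤ N.G (t + 1) := by
  refine Submodule.span_le.2 ?_
  rintro _ ⟨⟨s, i⟩, rfl⟩
  exact N.ybar_mem_G (s.2.trans t.lt_succ_self) i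

lemma F_le_succ (t : ℕ) : N.F t ≤ N.F (t + 1) := by
  refine Submodule.span_le.2 ?_
  rintro _ ⟨⟨s, i⟩, rfl⟩
  exact N.ybar_mem_F (s.2.trans t.lt_succ_self) i

lemma G_le_F (t : ℕ) : N.G t ≤ N.F t := by
  refine Submodule.span_le.2 ?_
  rintro _ ⟨⟨s, i⟩, rfl⟩
  exact N.ybar_mem_F s.2 _

lemma past_mono : Monotone N.past :=
  monotone_nat_of_le_succ fun _ => le_sup_left.trans le_sup_left

lemma w_mem_past (t : ℕ) (i) : N.w t i ∈ N.past (t + 1) :=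
  Submodule.mem_sup_left (Submodule.mem_sup_right (Submodule.subset_span ⟨i, rfl⟩))

lemma v_mem_past (t : ℕ) (i) : N.v t i ∈ N.past (t + 1) :=
  Submodule.mem_sup_right (Submodule.subset_span ⟨i, rfl⟩)

lemma mem_orthogonal_G_succ {t : ℕ} {h : H} (h₁ : h ∈ (N.G t)ᗮ)
    (h₂ : ∀ i, inner ℝ h (N.ybar t (Sum.inl i)) = 0) : h ∈ (N.G (t + 1))ᗮ := by
  refine mem_orthogonal_span_range ?_
  rintro ⟨⟨s, hs⟩, i⟩
  obtain hs | rfl := Nat.lt_succ_iff_lt_or_eq.1 hs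
  · exact Submodule.inner_left_of_mem_orthogonal (N.ybar_mem_G hs i) h₁
  · exact h₂ i

lemma state_succ (u : P.Policy H) (t : ℕ) :
    N.state u (t + 1) = matAct (P.A t) (N.state u t) + matAct (P.B t) (u t) + N.w t := rfl

lemma state_mem_past {u : P.Policy H} (hu : ∀ t i, u t i ∈ N.past t) (t : ℕ) :
    ∀ i, N.state u t i ∈ N.past t := by
  induction t with
  | zero => exact fun i => Submodule.subset_span ⟨i, rfl⟩
  | succ t ih =>
    intro i
    have hle := N.past_mono t.le_succ
    exact add_mem (add_mem (matAct_mem _ (fun j => hle (ih j)) i)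
      (matAct_mem _ (fun j => hle (hu t j)) i)) (N.w_mem_past t i)

lemma state_zero_mem_past (t : ℕ) (i) : N.state 0 t i ∈ N.past t :=
  N.state_mem_past (fun _ _ => zero_mem _) t i

lemma ybar_mem_past (t : ℕ) (i) : N.ybar t i ∈ N.past (t + 1) :=
  add_mem (matAct_mem _ (fun j => N.past_mono t.le_succ (N.state_zero_mem_past t j)) i)
    (N.v_mem_past t i)

lemma F_le_past (t : ℕ) : N.F t ≤ N.past t := by
  refine Submodule.span_le.2 ?_
  rintro _ ⟨⟨s, i⟩, rfl⟩
  exact N.past_mono (Nat.succ_le_of_lt s.2) (N.ybar_mem_past s i)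

/-- Control processes that are linear in the information available to the players. -/
def IsLin (u : P.Policy H) : Prop :=
  ∀ t, (∀ i, u t (Sum.inl i) ∈ N.G t) ∧ ∀ i, u t (Sum.inr i) ∈ N.F t

variable {N}

lemma IsLin.mem_F {u : P.Policy H} (hu : N.IsLin u) (t : ℕ) : ∀ i, u t i ∈ N.F t
  | Sum.inl i => N.G_le_F t ((hu t).1 i)
  | Sum.inr i => (hu t).2 i

variable (N)

/-- The part of the state that comes from the control. -/
lemma state_eq_add (u : P.Policy H) (t : ℕ) :
    N.state u t = N.state 0 t + solve t ((0, 0, u) : P.Drive H) := by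
  rw [state, state, ← map_add]
  congr 1
  ext <;> simp

variable {N}

lemma IsLin.solve_mem_F {u : P.Policy H} (hu : N.IsLin u) (t : ℕ) :
    ∀ i, solve t ((0, 0, u) : P.Drive H) i ∈ N.F t := by
  induction t with
  | zero => exact fun i => zero_mem _
  | succ t ih =>
    intro i
    exact N.F_le_succ t (add_mem (add_mem (matAct_mem _ ih i)
      (matAct_mem _ (hu.mem_F t) i)) (zero_mem _))

/-- By triangularity the first state block is driven by Player 1's controls alone, and these lie in
Player 1's span. -/
lemma IsLin.solve_mem_G {u : P.Policy H} (hu : N.IsLin u) (t : ℕ) :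
    ∀ i, solve t ((0, 0, u) : P.Drive H) (Sum.inl i) ∈ N.G t := by
  induction t with
  | zero => exact fun i => zero_mem _
  | succ t ih =>
    intro i
    exact N.G_le_succ t (add_mem (add_mem (matAct_fromBlocks_inl_mem _ _ _ ih i)
      (matAct_fromBlocks_inl_mem _ _ _ (hu t).1 i)) (zero_mem _))

variable (N)

/-- Player 2's estimate of the state. -/
noncomputable def est₂ (u : P.Policy H) (t : ℕ) : P.StateIdx t → H :=
  projT (N.F t) (N.state u t)

/-- Player 1's estimate of the state. -/
noncomputable def est₁ (u : P.Policy H) (t : ℕ) : P.StateIdx t → H :=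
  projT (N.G t) (N.state u t)

/-- Difference of the two estimates. -/
noncomputable def gap (u : P.Policy H) (t : ℕ) : P.StateIdx t → H := N.est₂ u t - N.est₁ u t

/-- Player 2's estimation error, which does not depend on the control. -/
noncomputable def err (t : ℕ) : P.StateIdx t → H := N.state 0 t - projT (N.F t) (N.state 0 t)

/-- The innovation in Player 2's estimate. -/
noncomputable def innov (t : ℕ) : P.StateIdx (t + 1) → H :=
  projT (N.F (t + 1)) (matAct (P.A t) (N.err t) + N.w t)

lemma est₁_mem (u : P.Policy H) (t : ℕ) (i) : N.est₁ u t i ∈ N.G t := projT_mem _ _ i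

lemma est₂_mem (u : P.Policy H) (t : ℕ) (i) : N.est₂ u t i ∈ N.F t := projT_mem _ _ i

lemma gap_mem (u : P.Policy H) (t : ℕ) (i) : N.gap u t i ∈ N.F t :=
  sub_mem (N.est₂_mem u t i) (N.G_le_F t (N.est₁_mem u t i))

lemma est₁_eq (u : P.Policy H) (t : ℕ) : N.est₁ u t = projT (N.G t) (N.est₂ u t) :=
  (projT_projT _ (N.G_le_F t) _).symm

lemma gap_mem_orthogonal (u : P.Policy H) (t : ℕ) (i) : N.gap u t i ∈ (N.G t)ᗮ := by
  rw [gap, est₁_eq]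
  exact sub_projT_mem _ _ i

lemma est₂_eq_add (u : P.Policy H) (t : ℕ) : N.est₂ u t = N.est₁ u t + N.gap u t := by
  rw [gap, add_sub_cancel]

lemma err_mem (t : ℕ) (i) : N.err t i ∈ (N.F t)ᗮ := sub_projT_mem _ _ i

variable {N}

/-- The contribution of the control lies in `F t`, so projection fixes it and the estimation error
is that of the uncontrolled state. -/
lemma IsLin.state_eq {u : P.Policy H} (hu : N.IsLin u) (t : ℕ) :
    N.state u t = N.est₂ u t + N.err t := by
  rw [est₂, err, state_eq_add, map_add, projT_of_mem _ (hu.solve_mem_F t)]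
  abel

/-- Both players know the control's contribution to the first block, so both projections fix it and
it cancels in the difference. -/
lemma IsLin.gap_inl {u : P.Policy H} (hu : N.IsLin u) (t : ℕ) (i) :
    N.gap u t (Sum.inl i) = N.gap 0 t (Sum.inl i) := by
  have h₁ := hu.solve_mem_G t i
  have h₂ := N.G_le_F t h₁
  rw [gap, gap, Pi.sub_apply, Pi.sub_apply, est₂, est₁, state_eq_add, map_add, map_add,
    Pi.add_apply, Pi.add_apply, projT_apply _ (solve t _), projT_apply _ (solve t _),
    Submodule.starProjection_eq_self_iff.2 h₁, Submodule.starProjection_eq_self_iff.2 h₂]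
  simp only [est₁, est₂]
  abel

section White

variable (hN : N.IsWhite)
include hN

lemma IsWhite.w_mem (t : ℕ) (i) : N.w t i ∈ (N.F t)ᗮ :=
  Submodule.orthogonal_le (N.F_le_past t) ((hN t).1 i)

lemma IsWhite.v_mem (t : ℕ) (i) : N.v t i ∈ (N.F t)ᗮ :=
  Submodule.orthogonal_le (N.F_le_past t) ((hN t).2 i)

/-- The vector being projected is orthogonal to `F t`, and the part that the projection removes is
orthogonal even to the larger `F (t + 1)`. -/
lemma IsWhite.innov_mem_orthogonal (t : ℕ) (i) : N.innov t i ∈ (N.F t)ᗮ := by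
  have h : matAct (P.A t) (N.err t) i + N.w t i ∈ (N.F t)ᗮ :=
    add_mem (matAct_mem _ (N.err_mem t) i) (hN.w_mem t i)
  have h' := sub_projT_mem (N.F (t + 1)) (matAct (P.A t) (N.err t) + N.w t) i
  have := sub_mem h (Submodule.orthogonal_le (N.F_le_succ t) h')
  rwa [Pi.add_apply, sub_sub_cancel] at this

/-- A vector in Player 2's span that is orthogonal to Player 1's span and to the known part of
the gap is orthogonal to Player 1's next span. -/
lemma IsWhite.mem_orthogonal_succ {t : ℕ} {r : H} (h₁ : r ∈ N.F t) (h₂ : r ∈ (N.G t)ᗮ)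
    (h₃ : ∀ i, inner ℝ r (N.gap 0 t (Sum.inl i)) = 0) : r ∈ (N.G (t + 1))ᗮ := by
  refine N.mem_orthogonal_G_succ h₂ fun i => ?_
  have h0 : N.IsLin 0 := fun _ => ⟨fun _ => zero_mem _, fun _ => zero_mem _⟩
  -- Since `C t` is block triangular, the new measurement sees the gap only through its first block.
  -- The other terms lie in `G t` or are orthogonal to `F t`.
  have e : N.ybar t (Sum.inl i) = matAct (P.C₁₁ t) (N.gap 0 t ∘ Sum.inl) i
      + matAct (P.C₁₁ t) (N.est₁ 0 t ∘ Sum.inl) i + matAct (P.C t) (N.err t) (Sum.inl i)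
      + N.v t (Sum.inl i) := by
    rw [ybar, h0.state_eq, est₂_eq_add, map_add, map_add]
    simp only [Pi.add_apply, matAct_fromBlocks_inl]
    abel
  rw [e, inner_add_right, inner_add_right, inner_add_right,
    Submodule.inner_right_of_mem_orthogonal h₁ (hN.v_mem t _),
    Submodule.inner_right_of_mem_orthogonal h₁ (matAct_mem _ (N.err_mem t) _),
    Submodule.inner_left_of_mem_orthogonal (matAct_mem _ (X := N.est₁ 0 t ∘ Sum.inl)
      (fun j => N.est₁_mem 0 t _) i) h₂,
    matAct_apply, inner_sum]
  simp [inner_smul_right, h₃]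

end White

/-- This is the Kalman recursion: the old estimate and the control are already known, and only the
old error and the new noise are updated. -/
lemma IsLin.est₂_succ {u : P.Policy H} (hu : N.IsLin u) (t : ℕ) :
    N.est₂ u (t + 1) = matAct (P.A t) (N.est₂ u t) + matAct (P.B t) (u t) + N.innov t := by
  have hle := N.F_le_succ t
  rw [est₂, state_succ, hu.state_eq t, map_add, map_add, map_add, innov, map_add, map_add,
    projT_of_mem _ (fun i => matAct_mem _ (fun j => hle (N.est₂_mem u t j)) i),
    projT_of_mem _ (fun i => matAct_mem _ (fun j => hle (hu.mem_F t j)) i)]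
  abel

/-- Recursions for Player 1's estimate and for the gap. -/
lemma IsLin.est₁_succ {u : P.Policy H} (hu : N.IsLin u) (t : ℕ) {a b : P.CtrlIdx t → H}
    (ha : ∀ i, a i ∈ N.G t) (hab : u t = a + b) :
    N.est₁ u (t + 1) = matAct (P.A t) (N.est₁ u t) + matAct (P.B t) a
      + projT (N.G (t + 1)) (matAct (P.A t) (N.gap u t) + matAct (P.B t) b + N.innov t) := by
  have hle := N.G_le_succ t
  rw [est₁_eq, hu.est₂_succ, est₂_eq_add, hab]
  simp only [map_add]
  rw [projT_of_mem _ (fun i => matAct_mem _ (fun j => hle (N.est₁_mem u t j)) i),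
    projT_of_mem _ (fun i => matAct_mem (P.B t) (fun j => hle (ha j)) i)]
  abel

lemma IsLin.gap_succ {u : P.Policy H} (hu : N.IsLin u) (t : ℕ) {a b : P.CtrlIdx t → H}
    (ha : ∀ i, a i ∈ N.G t) (hab : u t = a + b) :
    N.gap u (t + 1) = matAct (P.A t) (N.gap u t) + matAct (P.B t) b + N.innov t
      - projT (N.G (t + 1)) (matAct (P.A t) (N.gap u t) + matAct (P.B t) b + N.innov t) := by
  rw [gap, hu.est₁_succ t ha hab, hu.est₂_succ, est₂_eq_add, hab]
  simp only [map_add]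
  abel

end LinNoise

end TwoPlayerLQG

/-! ### Comparison of a linear control with constant gains on the estimates. -/

namespace TwoPlayerLQG

variable {P : TwoPlayerLQG} {H : Type*} [NormedAddCommGroup H] [InnerProductSpace ℝ H]

namespace LinNoise

variable (N : P.LinNoise H)

/-- The control processes with gains `K` on Player 1's estimate and `L` on the gap. -/
def HasGains (u : P.Policy H) (K L : ∀ t, Matrix (P.CtrlIdx t) (P.StateIdx t) ℝ) : Prop :=
  ∀ t, u t = matAct (K t) (N.est₁ u t) + matAct (L t) (N.gap u t)

/-- The control at time `t` with given gains in state `X`. -/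
noncomputable def gainCtrl (K L : ∀ t, Matrix (P.CtrlIdx t) (P.StateIdx t) ℝ) (t : ℕ)
    (X : P.StateIdx t → H) : P.CtrlIdx t → H :=
  matAct (K t) (projT (N.G t) X) + matAct (L t) (projT (N.F t) X - projT (N.G t) X)

/-- The closed-loop state with given gains. -/
noncomputable def gainState (K L : ∀ t, Matrix (P.CtrlIdx t) (P.StateIdx t) ℝ) :
    ∀ t, P.StateIdx t → H
  | 0 => N.x₀
  | t + 1 => matAct (P.A t) (gainState K L t)
      + matAct (P.B t) (N.gainCtrl K L t (gainState K L t)) + N.w t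

/-- The gain condition is implicit in `u`, but the state at time `t` involves only earlier controls;
the state is built first, by recursion, and the control read off from it. The zero rows of `L` keep
Player 1's controls in `G t`. -/
lemma exists_hasGains (K L : ∀ t, Matrix (P.CtrlIdx t) (P.StateIdx t) ℝ)
    (hL : ∀ t i j, L t (Sum.inl i) j = 0) :
    ∃ u : P.Policy H, N.IsLin u ∧ N.HasGains u K L := by
  let u : P.Policy H := fun t => N.gainCtrl K L t (N.gainState K L t)
  have h : ∀ t, N.state u t = N.gainState K L t := by
    intro t
    induction t with
    | zero => rfl
    | succ t ih => rw [state_succ, ih]; rfl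
  have hg : N.HasGains u K L := by
    intro t
    rw [gap, est₁, est₂, h]
    rfl
  refine ⟨u, fun t => ⟨fun i => ?_, fun i => ?_⟩, hg⟩
  · rw [hg t, Pi.add_apply, matAct_apply _ (N.gap u t)]
    simp only [hL, zero_smul, Finset.sum_const_zero, add_zero]
    exact matAct_mem _ (N.est₁_mem u t) _
  · rw [hg t]
    exact add_mem (matAct_mem _ (fun j => N.G_le_F t (N.est₁_mem u t j)) _)
      (matAct_mem _ (N.gap_mem u t) _)

variable {N}

lemma norm_add_sq_le {S : Submodule ℝ H} {a b c : H} (hb : b ∈ S) (hc : c ∈ Sᗮ)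
    (h : ‖a‖ ^ 2 ≤ ‖b‖ ^ 2) : ‖a‖ ^ 2 ≤ ‖b + c‖ ^ 2 := by
  rw [norm_add_sq_of_mem hb hc]
  nlinarith [sq_nonneg ‖c‖]

/-- Adding the same orthogonal vector preserves the comparison of norms. -/
lemma norm_add_sq_le_add {S S' : Submodule ℝ H} {a b c c' : H} (ha : a ∈ S) (hb : b ∈ S')
    (hc : c ∈ Sᗮ) (hc' : c' ∈ S'ᗮ) (h : ‖a‖ ^ 2 ≤ ‖b‖ ^ 2) (h' : ‖c‖ ^ 2 ≤ ‖c'‖ ^ 2) :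
    ‖a + c‖ ^ 2 ≤ ‖b + c'‖ ^ 2 := by
  rw [norm_add_sq_of_mem ha hc, norm_add_sq_of_mem hb hc']
  linarith

lemma norm_sub_starProjection_sq (S : Submodule ℝ H) [S.HasOrthogonalProjection] (a : H) :
    ‖a - S.starProjection a‖ ^ 2 = ‖a‖ ^ 2 - ‖S.starProjection a‖ ^ 2 := by
  have h := norm_add_sq_of_mem (Submodule.starProjection_apply_mem S a)
    (Submodule.sub_starProjection_mem_orthogonal (K := S) a)
  rw [add_sub_cancel] at h
  linarith

/-- A linear control process together with its regressions: `K` regresses the part known to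
Player 1 on Player 1's estimate, with remainder `r`, and `L` regresses the rest on the gap,
with remainder `q`. -/
structure Regression (N : P.LinNoise H) (u : P.Policy H)
    (K L : ∀ t, Matrix (P.CtrlIdx t) (P.StateIdx t) ℝ) (r q : ∀ t, P.CtrlIdx t → H) : Prop where
  lin : N.IsLin u
  eq : ∀ t, u t = (matAct (K t) (N.est₁ u t) + r t) + (matAct (L t) (N.gap u t) + q t)
  L_inl : ∀ t i j, L t (Sum.inl i) j = 0
  q_inl : ∀ t i, q t (Sum.inl i) = 0
  r_mem : ∀ t i, r t i ∈ N.G t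
  r_orth : ∀ t i, r t i ∈ (Submodule.span ℝ (Set.range (N.est₁ u t)))ᗮ
  q_mem : ∀ t i, q t i ∈ N.F t
  q_mem_orthogonal : ∀ t i, q t i ∈ (N.G t)ᗮ
  q_orth : ∀ t i, q t i ∈ (Submodule.span ℝ (Set.range (N.gap u t)))ᗮ

lemma IsLin.exists_regression {u : P.Policy H} (hu : N.IsLin u) :
    ∃ K L r q, N.Regression u K L r q := by
  choose K hK using fun t => _root_.exists_regression (N.est₁ u t) (projT (N.G t) (u t))
  -- Player 1's controls lie in `G t`, so nothing remains of them after projection. Only Player 2's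
  -- rows are regressed, and Player 1's rows of the gain are set to zero.
  choose L hL using fun t => _root_.exists_regression (N.gap u t)
    ((u t - projT (N.G t) (u t)) ∘ Sum.inr)
  let L' : ∀ t, Matrix (P.CtrlIdx t) (P.StateIdx t) ℝ :=
    fun t => Matrix.of (Sum.elim (fun _ _ => 0) (L t))
  let q : ∀ t, P.CtrlIdx t → H :=
    fun t => u t - projT (N.G t) (u t) - matAct (L' t) (N.gap u t)
  have hq1 : ∀ t i, q t (Sum.inl i) = 0 := fun t i => by
    have h1 : matAct (L' t) (N.gap u t) (Sum.inl i) = 0 := by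
      rw [matAct_apply]
      exact Finset.sum_eq_zero fun j _ => zero_smul ℝ (N.gap u t j)
    simp only [q, Pi.sub_apply, h1, projT_apply,
      Submodule.starProjection_eq_self_iff.2 ((hu t).1 i), sub_self]
  have hq2 : ∀ t i, q t i ∈ N.F t := fun t i =>
    sub_mem (sub_mem (hu.mem_F t i) (N.G_le_F t (projT_mem _ _ i)))
      (matAct_mem _ (N.gap_mem u t) i)
  have hq3 : ∀ t i, q t i ∈ (N.G t)ᗮ := fun t i =>
    sub_mem (sub_projT_mem _ _ i) (matAct_mem _ (N.gap_mem_orthogonal u t) i)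
  refine ⟨K, L', fun t => projT (N.G t) (u t) - matAct (K t) (N.est₁ u t), q,
    hu, fun t => ?_, fun _ _ _ => rfl, hq1, fun t i => ?_, fun t i => hK t i, hq2, hq3,
    fun t i => ?_⟩
  · simp only [q]
    abel
  · exact sub_mem (projT_mem _ _ i) (matAct_mem _ (N.est₁_mem u t) i)
  · rcases i with i | i
    · rw [hq1]
      exact zero_mem _
    · exact hL t i

section Compare

variable {u u' : P.Policy H} {K L : ∀ t, Matrix (P.CtrlIdx t) (P.StateIdx t) ℝ}
  {r q : ∀ t, P.CtrlIdx t → H}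

lemma Regression.part_mem (h : N.Regression u K L r q) (t : ℕ) (i) :
    (matAct (K t) (N.est₁ u t) + r t) i ∈ N.G t :=
  add_mem (matAct_mem _ (N.est₁_mem u t) i) (h.r_mem t i)

lemma Regression.B_q_inl (h : N.Regression u K L r q) (t : ℕ) (i) :
    matAct (P.B t) (q t) (Sum.inl i) = 0 := by
  rw [matAct_fromBlocks_inl, matAct_apply]
  simp [h.q_inl]

lemma Regression.inner_q_gap (h : N.Regression u K L r q) (t : ℕ) (i j) :
    inner ℝ (q t i) (N.gap u t j) = 0 :=
  Submodule.inner_left_of_mem_orthogonal (Submodule.subset_span (Set.mem_range_self j))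
    (h.q_orth t i)

/-- The remainder is orthogonal to the gap, whose first block equals that of the uncontrolled gap,
the only thing in `F t` that Player 1's next measurement adds to `G t`. -/
lemma Regression.q_mem_succ (hN : N.IsWhite) (h : N.Regression u K L r q) (t : ℕ) (i) :
    q t i ∈ (N.G (t + 1))ᗮ :=
  hN.mem_orthogonal_succ (h.q_mem t i) (h.q_mem_orthogonal t i) fun j => by
    rw [← h.lin.gap_inl]
    exact h.inner_q_gap t i _

/-- The drift of the gap. -/
noncomputable def drift (N : P.LinNoise H) (u : P.Policy H)
    (L : ∀ t, Matrix (P.CtrlIdx t) (P.StateIdx t) ℝ) (t : ℕ) : P.StateIdx (t + 1) → H :=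
  matAct (P.A t + P.B t * L t) (N.gap u t) + N.innov t

lemma gap_step_eq (t : ℕ) :
    matAct (P.A t) (N.gap u t) + matAct (P.B t) (matAct (L t) (N.gap u t) + q t) + N.innov t
      = N.drift u L t + matAct (P.B t) (q t) := by
  rw [drift, matAct_add_left, ← matAct_matAct, map_add]
  abel

lemma Regression.proj_gap_step (hN : N.IsWhite) (h : N.Regression u K L r q) (t : ℕ) :
    projT (N.G (t + 1)) (N.drift u L t + matAct (P.B t) (q t))
      = projT (N.G (t + 1)) (N.drift u L t) := by
  rw [map_add, projT_of_mem_orthogonal _ (fun i => matAct_mem (P.B t) (h.q_mem_succ hN t) i),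
    add_zero]

lemma Regression.est₁_succ (hN : N.IsWhite) (h : N.Regression u K L r q) (t : ℕ) :
    N.est₁ u (t + 1) = matAct (P.A t + P.B t * K t) (N.est₁ u t) + matAct (P.B t) (r t)
      + projT (N.G (t + 1)) (N.drift u L t) := by
  rw [h.lin.est₁_succ t (h.part_mem t) (h.eq t), gap_step_eq, h.proj_gap_step hN, matAct_add_left,
    ← matAct_matAct, map_add]
  abel

lemma Regression.gap_succ (hN : N.IsWhite) (h : N.Regression u K L r q) (t : ℕ) :
    N.gap u (t + 1) = N.drift u L t - projT (N.G (t + 1)) (N.drift u L t)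
      + matAct (P.B t) (q t) := by
  rw [h.lin.gap_succ t (h.part_mem t) (h.eq t), gap_step_eq, h.proj_gap_step hN]
  abel

lemma HasGains.regression (hu : N.IsLin u') (h : N.HasGains u' K L)
    (hL : ∀ t i j, L t (Sum.inl i) j = 0) : N.Regression u' K L 0 0 where
  lin := hu
  eq t := by
    have := h t
    simpa using this
  L_inl := hL
  q_inl _ _ := rfl
  r_mem _ _ := zero_mem _
  r_orth _ _ := zero_mem _
  q_mem _ _ := zero_mem _
  q_mem_orthogonal _ _ := zero_mem _
  q_orth _ _ := zero_mem _

/-- Under `hd` the difference of the gaps is invisible to Player 1 at the next time. The corrections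
then agree and cancel, leaving a linear recursion for the difference driven by `q` alone. -/
lemma Regression.gap_sub_succ (hN : N.IsWhite) (h : N.Regression u K L r q)
    (h' : N.Regression u' K L 0 0) (t : ℕ)
    (hd : ∀ i j, inner ℝ ((N.gap u t - N.gap u' t) i) (N.gap 0 t (Sum.inl j)) = 0) :
    (∀ i, (N.gap u t - N.gap u' t) i ∈ (N.G (t + 1))ᗮ) ∧
    projT (N.G (t + 1)) (N.drift u L t) = projT (N.G (t + 1)) (N.drift u' L t) ∧
    N.gap u (t + 1) - N.gap u' (t + 1)
      = matAct (P.A t + P.B t * L t) (N.gap u t - N.gap u' t) + matAct (P.B t) (q t) := by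
  have h1 : ∀ i, (N.gap u t - N.gap u' t) i ∈ (N.G (t + 1))ᗮ := fun i =>
    hN.mem_orthogonal_succ (sub_mem (N.gap_mem u t i) (N.gap_mem u' t i))
      (sub_mem (N.gap_mem_orthogonal u t i) (N.gap_mem_orthogonal u' t i)) (hd i)
  have h2 : N.drift u L t - N.drift u' L t
      = matAct (P.A t + P.B t * L t) (N.gap u t - N.gap u' t) := by
    rw [drift, drift, map_sub]
    abel
  have h3 : projT (N.G (t + 1)) (N.drift u L t) = projT (N.G (t + 1)) (N.drift u' L t) := by
    rw [← sub_eq_zero, ← map_sub, h2]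
    exact projT_of_mem_orthogonal _ fun i => matAct_mem _ h1 i
  refine ⟨h1, h3, ?_⟩
  rw [h.gap_succ hN, h'.gap_succ hN, h3, ← h2]
  simp only [Pi.zero_apply, map_zero, add_zero]
  abel

/-- The heart of the comparison. The new difference is a linear image of the old one plus `B q`;
both are orthogonal to `G (t + 1)`, so only their pairing with the first block of the drift matters.
That block is the old first block of the gap under `A₁₁`, plus an innovation. -/
lemma Regression.inner_gap_sub (hN : N.IsWhite) (h : N.Regression u K L r q)
    (h' : N.Regression u' K L 0 0) (t : ℕ) :
    ∀ i j, inner ℝ ((N.gap u t - N.gap u' t) i) (N.gap 0 t (Sum.inl j)) = 0 := by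
  induction t with
  | zero =>
    intro i j
    have : N.gap u 0 = N.gap u' 0 := rfl
    rw [this, sub_self]
    exact inner_zero_left _
  | succ t ih =>
    intro i j
    obtain ⟨h1, h3, h4⟩ := h.gap_sub_succ hN h' t ih
    -- `q` is orthogonal to the gap by regression, and to the innovation because it lies in `F t`.
    have hin : ∀ j, inner ℝ (matAct (P.B t) (q t) i) (N.drift u L t j) = 0 := fun j => by
      have hq : ∀ k, q t k ∈ (Submodule.span ℝ (Set.range (N.gap u t)))ᗮ := h.q_orth t
      rw [drift, Pi.add_apply, inner_add_right,
        Submodule.inner_left_of_mem_orthogonal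
          (matAct_mem_span _ _ _) (matAct_mem (P.B t) hq i),
        Submodule.inner_right_of_mem_orthogonal (matAct_mem (P.B t) (h.q_mem t) i)
          (hN.innov_mem_orthogonal t j), add_zero]
    have hd0 : ∀ i j, inner ℝ ((N.gap u t - N.gap u' t) i) (N.gap u t (Sum.inl j)) = 0 := by
      intro i j
      rw [h.lin.gap_inl]
      exact ih i j
    have hdF : ∀ i, (N.gap u t - N.gap u' t) i ∈ N.F t := fun i =>
      sub_mem (N.gap_mem u t i) (N.gap_mem u' t i)
    rw [h4, ← h.lin.gap_inl, h.gap_succ hN]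
    simp only [Pi.add_apply, Pi.sub_apply, h.B_q_inl, add_zero, inner_add_left, inner_sub_right,
      hin]
    rw [Submodule.inner_left_of_mem_orthogonal (projT_mem _ _ _)
      (matAct_mem _ (h.q_mem_succ hN t) i), Submodule.inner_left_of_mem_orthogonal
      (projT_mem _ _ _) (matAct_mem _ h1 i), drift, Pi.add_apply, inner_add_right,
      Submodule.inner_right_of_mem_orthogonal (matAct_mem _ hdF i)
        (hN.innov_mem_orthogonal t _)]
    -- Feedback from the gap acts through Player 2 only, which cannot move the first block.
    have hbl : matAct (P.A t + P.B t * L t) (N.gap u t) (Sum.inl j)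
        = matAct (P.A₁₁ t) (N.gap u t ∘ Sum.inl) j := by
      rw [matAct_add_left, ← matAct_matAct, Pi.add_apply, matAct_fromBlocks_inl,
        matAct_fromBlocks_inl, matAct_apply (P.B₁₁ t)]
      simp [matAct_apply (L t), h.L_inl]
    rw [hbl, matAct_apply (P.A₁₁ t), matAct_apply, inner_sum]
    simp only [sum_inner, inner_smul_left, inner_smul_right, Function.comp_apply, hd0]
    simp

/-- The term `B q` is orthogonal to the rest of the new gap and can be dropped. The rest has squared
norm that of the drift minus that of its projection; the projections agree in both loops, and the
drifts compare by induction, the innovation being common and orthogonal. All `c` are needed at once,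
since the induction replaces `c` by `c ᵥ* (A + B L)`. -/
lemma Regression.comb_gap_le (hN : N.IsWhite) (h : N.Regression u K L r q)
    (h' : N.Regression u' K L 0 0) (t : ℕ) :
    ∀ c, ‖comb c (N.gap u' t)‖ ^ 2 ≤ ‖comb c (N.gap u t)‖ ^ 2 := by
  induction t with
  | zero => exact fun c => le_rfl
  | succ t ih =>
    intro c
    obtain ⟨-, h3, -⟩ := h.gap_sub_succ hN h' t (h.inner_gap_sub hN h' t)
    have hB : comb c (matAct (P.B t) (q t)) ∈
        (N.G (t + 1) ⊔ Submodule.span ℝ (Set.range (N.drift u L t)))ᗮ := by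
      rw [← Submodule.inf_orthogonal]
      refine ⟨comb_mem _ (matAct_mem _ (h.q_mem_succ hN t)), ?_⟩
      refine comb_mem _ (matAct_mem _ fun i => ?_)
      refine mem_orthogonal_span_range fun j => ?_
      rw [drift, Pi.add_apply, inner_add_right,
        Submodule.inner_left_of_mem_orthogonal (matAct_mem_span _ _ _) (h.q_orth t i),
        Submodule.inner_right_of_mem_orthogonal (h.q_mem t i)
          (hN.innov_mem_orthogonal t j), add_zero]
    have hm : comb c (N.drift u L t - projT (N.G (t + 1)) (N.drift u L t)) ∈
        N.G (t + 1) ⊔ Submodule.span ℝ (Set.range (N.drift u L t)) :=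
      comb_mem _ fun i => sub_mem (Submodule.mem_sup_right (Submodule.subset_span ⟨i, rfl⟩))
        (Submodule.mem_sup_left (projT_mem _ _ i))
    have e' : N.gap u' (t + 1) = N.drift u' L t - projT (N.G (t + 1)) (N.drift u' L t) := by
      rw [h'.gap_succ hN]
      simp
    rw [h.gap_succ hN, map_add, e']
    refine norm_add_sq_le hm hB ?_
    have h5 : comb c (projT (N.G (t + 1)) (N.drift u L t))
        = comb c (projT (N.G (t + 1)) (N.drift u' L t)) := by rw [h3]
    rw [comb_projT, comb_projT] at h5
    rw [map_sub, map_sub, comb_projT, comb_projT, norm_sub_starProjection_sq,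
      norm_sub_starProjection_sq, h5]
    generalize (N.G (t + 1)).starProjection (comb c (N.drift u' L t)) = p
    simp only [drift, map_add (comb c), comb_matAct]
    refine sub_le_sub_right (norm_add_sq_le_add (S := N.F t) (S' := N.F t)
      (comb_mem _ (N.gap_mem u' t)) (comb_mem _ (N.gap_mem u t))
      (comb_mem _ (hN.innov_mem_orthogonal t)) (comb_mem _ (hN.innov_mem_orthogonal t))
      (ih _) le_rfl) _

/-- The drift has no component in `G t`, so its projection is new information only. This makes the
recursion for Player 1's estimate an orthogonal sum. -/
lemma IsWhite.proj_drift_mem (hN : N.IsWhite) (t : ℕ) (i) :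
    projT (N.G (t + 1)) (N.drift u L t) i ∈ (N.G t)ᗮ := by
  have h1 : N.drift u L t i ∈ (N.G t)ᗮ :=
    add_mem (matAct_mem _ (N.gap_mem_orthogonal u t) i)
      (Submodule.orthogonal_le (N.G_le_F t) (hN.innov_mem_orthogonal t i))
  have h2 := Submodule.orthogonal_le (N.G_le_succ t)
    (sub_projT_mem (N.G (t + 1)) (N.drift u L t) i)
  have := sub_mem h1 h2
  rwa [sub_sub_cancel] at this

/-- The correction is the same in both loops and orthogonal to `G t`, while `r` is orthogonal to the
estimate, so Pythagoras applies twice. -/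
lemma Regression.comb_est₁_le (hN : N.IsWhite) (h : N.Regression u K L r q)
    (h' : N.Regression u' K L 0 0) (t : ℕ) :
    ∀ c, ‖comb c (N.est₁ u' t)‖ ^ 2 ≤ ‖comb c (N.est₁ u t)‖ ^ 2 := by
  induction t with
  | zero => exact fun c => le_rfl
  | succ t ih =>
    intro c
    obtain ⟨-, h3, -⟩ := h.gap_sub_succ hN h' t (h.inner_gap_sub hN h' t)
    have e' : N.est₁ u' (t + 1) = matAct (P.A t + P.B t * K t) (N.est₁ u' t)
        + projT (N.G (t + 1)) (N.drift u' L t) := by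
      rw [h'.est₁_succ hN]
      simp
    rw [h.est₁_succ hN, e', ← h3, map_add, map_add, map_add]
    refine norm_add_sq_le_add (S := N.G t) (S' := N.G t)
      (comb_mem _ (matAct_mem _ (N.est₁_mem u' t)))
      (add_mem (comb_mem _ (matAct_mem _ (N.est₁_mem u t)))
        (comb_mem _ (matAct_mem _ (h.r_mem t))))
      (comb_mem _ (hN.proj_drift_mem t)) (comb_mem _ (hN.proj_drift_mem t)) ?_ le_rfl
    rw [comb_matAct, comb_matAct]
    exact norm_add_sq_le (comb_mem_span _ _)
      (comb_mem _ (matAct_mem _ (h.r_orth t))) (ih _)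

/-- Removing the remainders of the regressions does not increase any linear functional of the
state and the control. -/
lemma Regression.comb_stage_le (hN : N.IsWhite) (h : N.Regression u K L r q)
    (h' : N.Regression u' K L 0 0) (t : ℕ) (c) (d) :
    ‖comb c (N.state u' t) + comb d (u' t)‖ ^ 2 ≤ ‖comb c (N.state u t) + comb d (u t)‖ ^ 2 := by
  -- Three mutually orthogonal parts: in `G t`, in `F t` orthogonal to `G t`, and orthogonal to `F
  -- t`. The last is the same in both loops.
  have e : ∀ {u : P.Policy H} {r q : ∀ t, P.CtrlIdx t → H}, N.Regression u K L r q →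
      comb c (N.state u t) + comb d (u t) =
        ((comb (c + d ᵥ* K t) (N.est₁ u t) + comb d (r t))
          + (comb (c + d ᵥ* L t) (N.gap u t) + comb d (q t))) + comb c (N.err t) := by
    intro u r q h
    rw [h.lin.state_eq, est₂_eq_add]
    conv_lhs => rw [h.eq t]
    simp only [map_add, comb_add_left, comb_matAct]
    abel
  rw [e h, e h']
  simp only [Pi.zero_apply, map_zero, add_zero]
  have hG := fun u : P.Policy H => comb_mem (c + d ᵥ* K t) (N.est₁_mem u t)
  have hF := fun u : P.Policy H => comb_mem (c + d ᵥ* L t) (N.gap_mem u t)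
  have hO := fun u : P.Policy H => comb_mem (c + d ᵥ* L t) (N.gap_mem_orthogonal u t)
  have hr := comb_mem d (h.r_mem t)
  refine norm_add_sq_le_add (S := N.F t) (S' := N.F t)
    (add_mem (N.G_le_F t (hG u')) (hF u'))
    (add_mem (N.G_le_F t (add_mem (hG u) hr)) (add_mem (hF u) (comb_mem d (h.q_mem t))))
    (comb_mem _ (N.err_mem t)) (comb_mem _ (N.err_mem t)) ?_ le_rfl
  refine norm_add_sq_le_add (S := N.G t) (S' := N.G t) (hG u') (add_mem (hG u) hr) (hO u')
    (add_mem (hO u) (comb_mem d (h.q_mem_orthogonal t))) ?_ ?_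
  · exact norm_add_sq_le (comb_mem_span _ _)
      (comb_mem _ (h.r_orth t)) (h.comb_est₁_le hN h' t _)
  · exact norm_add_sq_le (comb_mem_span _ _)
      (comb_mem _ (h.q_orth t)) (h.comb_gap_le hN h' t _)

end Compare

/-- The cost of a control process. -/
noncomputable def J (N : P.LinNoise H) (u : P.Policy H) : ℝ :=
  costB (N.x₀, N.w, u) (N.x₀, N.w, u)

/-! ### Existence of an optimal linear control. -/

section PosSemidef

variable (hN : N.IsWhite) (hcost : ∀ t < P.T, (P.stageMatrix t).PosSemidef)
  (hfinal : P.Pfinal.PosSemidef)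
include hcost hfinal

include hN in
/-- Every linear control process is at most as good as one given by gains on the estimates. -/
lemma IsLin.exists_hasGains_le {u : P.Policy H} (hu : N.IsLin u) :
    ∃ K L u', (∀ t i j, L t (Sum.inl i) j = 0) ∧ N.IsLin u' ∧ N.HasGains u' K L ∧
      N.J u' ≤ N.J u := by
  obtain ⟨K, L, r, q, h⟩ := hu.exists_regression
  obtain ⟨u', hu', hg⟩ := N.exists_hasGains K L h.L_inl
  have h' := hg.regression hu' h.L_inl
  refine ⟨K, L, u', h.L_inl, hu', hg, ?_⟩
  rw [J, J, costB_apply, costB_apply]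
  refine add_le_add (Finset.sum_le_sum fun t ht =>
    quadB_le (hcost t (Finset.mem_range.1 ht)) fun c => ?_) (quadB_le hfinal fun c => ?_)
  · rw [stage_apply, stage_apply, comb_sumElim, comb_sumElim]
    exact h.comb_stage_le hN h' t _ _
  · have := h.comb_stage_le hN h' P.T c 0
    rwa [comb_zero_left, comb_zero_left, add_zero, add_zero] at this

/-- There is an optimal linear control process. -/
lemma exists_optimal_lin : ∃ u : P.Policy H, N.IsLin u ∧ ∀ u', N.IsLin u' → N.J u ≤ N.J u' := by
  classical
  -- Only controls before the horizon enter the cost, so a finite-dimensional space suffices; later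
  -- controls are set to zero.
  let V : Type _ := ∀ t : Fin P.T, (Fin (P.m₁ t) → N.G t) × (Fin (P.m₂ t) → N.F t)
  let e : V → P.Policy H := fun v t =>
    if h : t < P.T then Sum.elim (fun i => ((v ⟨t, h⟩).1 i : H)) (fun i => ((v ⟨t, h⟩).2 i : H))
    else 0
  let j : V →ₗ[ℝ] P.Drive H :=
    { toFun := fun v => (0, 0, e v)
      map_add' := fun v v' => by
        ext t i
        · simp
        · simp
        · by_cases h : t < P.T <;> rcases i with i | i <;> simp [e, h] <;> rfl
      map_smul' := fun c v => by
        ext t i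
        · simp
        · simp
        · by_cases h : t < P.T <;> rcases i with i | i <;> simp [e, h] <;> rfl }
  obtain ⟨v₀, hv⟩ := exists_minimizer costB (costB_comm hcost hfinal)
    (costB_nonneg hcost hfinal) j (N.x₀, N.w, 0)
  have hj : ∀ v, ((N.x₀, N.w, 0) : P.Drive H) + j v = (N.x₀, N.w, e v) := fun v => by
    ext <;> simp [j]
  refine ⟨e v₀, fun t => ?_, fun u' hu' => ?_⟩
  · by_cases h : t < P.T <;> simp [e, h]
  · let v : V := fun t => (fun i => ⟨_, (hu' t).1 i⟩, fun i => ⟨_, (hu' t).2 i⟩)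
    have h1 := hv v
    rw [hj, hj] at h1
    refine h1.trans (le_of_eq (costB_congr (d' := (N.x₀, N.w, u')) rfl (fun _ _ => rfl)
      fun t ht => ?_))
    ext (i | i) <;> simp [e, ht, v]

end PosSemidef

/-! ### Nonlinear controls: projection onto the linear ones, and uniqueness. -/

variable (N) in
/-- Admissible control processes: each control is orthogonal to whatever part of the noise is
orthogonal to the information. -/
def IsAdm (u : P.Policy H) : Prop :=
  ∀ t n, ∀ h ∈ N.past n, (h ∈ (N.G t)ᗮ → ∀ i, inner ℝ (u t (Sum.inl i)) h = 0) ∧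
    (h ∈ (N.F t)ᗮ → ∀ i, inner ℝ (u t (Sum.inr i)) h = 0)

lemma IsLin.isAdm {u : P.Policy H} (hu : N.IsLin u) : N.IsAdm u := fun t _ _ _ =>
  ⟨fun h i => Submodule.inner_right_of_mem_orthogonal ((hu t).1 i) h,
    fun h i => Submodule.inner_right_of_mem_orthogonal ((hu t).2 i) h⟩

lemma IsAdm.add {u v : P.Policy H} (hu : N.IsAdm u) (hv : N.IsAdm v) : N.IsAdm (u + v) :=
  fun t n h hh => ⟨fun h' i => by
      rw [Pi.add_apply, Pi.add_apply, inner_add_left, (hu t n h hh).1 h', (hv t n h hh).1 h',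
        add_zero],
    fun h' i => by
      rw [Pi.add_apply, Pi.add_apply, inner_add_left, (hu t n h hh).2 h', (hv t n h hh).2 h',
        add_zero]⟩

lemma IsAdm.smul {u : P.Policy H} (c : ℝ) (hu : N.IsAdm u) : N.IsAdm (c • u) :=
  fun t n h hh => ⟨fun h' i => by
      rw [Pi.smul_apply, Pi.smul_apply, inner_smul_left, (hu t n h hh).1 h', mul_zero],
    fun h' i => by
      rw [Pi.smul_apply, Pi.smul_apply, inner_smul_left, (hu t n h hh).2 h', mul_zero]⟩

/-- The projection is self-adjoint, so it can be moved from `a` to `h`; the residual of `h` stays in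
`E`. -/
lemma inner_sub_starProjection_eq_zero {S E : Submodule ℝ H} [S.HasOrthogonalProjection] {a h : H}
    (hSE : S ≤ E) (hh : h ∈ E) (ha : ∀ k ∈ E, k ∈ Sᗮ → inner ℝ a k = 0) :
    inner ℝ (a - S.starProjection a) h = 0 := by
  have h1 := ha (h - S.starProjection h)
    (sub_mem hh (hSE (Submodule.starProjection_apply_mem _ _)))
    (Submodule.sub_starProjection_mem_orthogonal _)
  rw [inner_sub_right] at h1
  rw [inner_sub_left, ← h1]
  congr 1
  exact S.starProjection_isSymmetric a h

lemma quadB_eq_zero_of_inner {ι : Type*} [Fintype ι] (M : Matrix ι ι ℝ) {X Y : ι → H}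
    (h : ∀ i j, inner ℝ (X i) (Y j) = 0) : quadB M X Y = 0 := by
  simp [quadB_apply, h]

lemma eq_zero_of_quadB_posDef {ι : Type*} [Fintype ι] {M : Matrix ι ι ℝ} (hM : M.PosDef)
    {X : ι → H} (h : quadB M X X = 0) : X = 0 := by
  classical
  obtain ⟨L, hL, hq⟩ := exists_quadB_eq (H := H) hM.posSemidef
  rw [hq, Finset.sum_eq_zero_iff_of_nonneg fun _ _ => real_inner_self_nonneg] at h
  have h0 : matAct L X = 0 := by
    ext k
    exact inner_self_eq_zero.1 (h k (Finset.mem_univ k))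
  have h1 : matAct (M⁻¹ * M) X = 0 := by
    rw [← matAct_matAct]
    conv_lhs => enter [2]; rw [hL]
    rw [← matAct_matAct, h0, map_zero, map_zero]
  rwa [Matrix.nonsing_inv_mul _ ((Matrix.isUnit_iff_isUnit_det _).1 hM.isUnit), matAct_one] at h1

section PosSemidef

variable (hcost : ∀ t < P.T, (P.stageMatrix t).PosSemidef) (hfinal : P.Pfinal.PosSemidef)
include hcost hfinal

/-- Projecting an admissible control process onto the linear ones does not increase the cost. -/
lemma IsAdm.exists_isLin_le {u : P.Policy H} (hu : N.IsAdm u) :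
    ∃ u', N.IsLin u' ∧ N.J u' ≤ N.J u := by
  let u' : P.Policy H := fun t =>
    Sum.elim (projT (N.G t) (u t ∘ Sum.inl)) (projT (N.F t) (u t ∘ Sum.inr))
  have hlin : N.IsLin u' := fun t => ⟨fun i => projT_mem _ _ i, fun i => projT_mem _ _ i⟩
  -- The discarded part is orthogonal to the noise of all times, future included. Passing to `max t
  -- n` ensures that the ambient span contains `F t`.
  have hδ : ∀ t i, ∀ n, ∀ h ∈ N.past n, inner ℝ ((u - u') t i) h = 0 := by
    intro t i n h hh
    have hle : N.F t ≤ N.past (max t n) :=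
      (N.F_le_past t).trans (N.past_mono (le_max_left _ _))
    have hh' := N.past_mono (le_max_right t n) hh
    rcases i with i | i
    · exact inner_sub_starProjection_eq_zero ((N.G_le_F t).trans hle) hh'
        fun k hk hk' => (hu t _ k hk).1 hk' i
    · exact inner_sub_starProjection_eq_zero hle hh' fun k hk hk' => (hu t _ k hk).2 hk' i
  have hx : ∀ t i, ∀ n, ∀ h ∈ N.past n,
      inner ℝ (solve t ((0, 0, u - u') : P.Drive H) i) h = 0 := by
    intro t
    induction t with
    | zero => exact fun i n h _ => inner_zero_left h
    | succ t ih =>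
      intro i n h hh
      rw [solve_succ, Pi.add_apply, Pi.add_apply, matAct_apply, matAct_apply, inner_add_left,
        inner_add_left, sum_inner, sum_inner]
      simp [inner_smul_left, ih _ n h hh, hδ t _ n h hh, -Fintype.sum_sum_type, -Pi.sub_apply]
  have hp : ∀ t i, u' t i ∈ N.past t := fun t i => N.F_le_past t (hlin.mem_F t i)
  -- State and control under `u'` are combinations of noise, so the cost splits without a cross
  -- term.
  have hcross : costB ((0, 0, u - u') : P.Drive H) (N.x₀, N.w, u') = 0 := by
    rw [costB_apply, quadB_eq_zero_of_inner P.Pfinal (Y := solve P.T (N.x₀, N.w, u'))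
      fun i j => hx P.T i _ _ (N.state_mem_past hp P.T j), add_zero]
    refine Finset.sum_eq_zero fun t _ => quadB_eq_zero_of_inner _ ?_
    rintro (i | i) (j | j)
    · exact hx _ i _ _ (N.state_mem_past hp _ j)
    · exact hx _ i _ _ (hp t j)
    · exact hδ _ i _ _ (N.state_mem_past hp _ j)
    · exact hδ _ i _ _ (hp t j)
  have e : ((N.x₀, N.w, u) : P.Drive H) = (0, 0, u - u') + (N.x₀, N.w, u') := by
    ext <;> simp
  refine ⟨u', hlin, ?_⟩
  rw [J, J, e, map_add costB, LinearMap.add_apply, map_add, map_add,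
    costB_comm hcost hfinal (N.x₀, N.w, u') (0, 0, u - u'), hcross]
  linarith [costB_nonneg hcost hfinal ((0, 0, u - u') : P.Drive H)]

/-- Some control process given by gains on the estimates is optimal among all admissible ones. -/
theorem exists_hasGains_optimal (hN : N.IsWhite) :
    ∃ K L u, (∀ t i j, L t (Sum.inl i) j = 0) ∧ N.IsLin u ∧ N.HasGains u K L ∧
      ∀ u', N.IsAdm u' → N.J u ≤ N.J u' := by
  obtain ⟨u₀, hu₀, hopt⟩ := N.exists_optimal_lin hcost hfinal
  obtain ⟨K, L, u, hL, hu, hg, hle⟩ := hu₀.exists_hasGains_le hN hcost hfinal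
  refine ⟨K, L, u, hL, hu, hg, fun u' hu' => ?_⟩
  obtain ⟨u'', hu'', hle'⟩ := hu'.exists_isLin_le hcost hfinal
  exact hle.trans ((hopt u'' hu'').trans hle')

/-- With a positive definite control cost, only the zero control is free of cost. -/
lemma ctrl_eq_zero_of_costB (hR : ∀ t < P.T, (P.R t).PosDef) {u : P.Policy H}
    (h : costB ((0, 0, u) : P.Drive H) (0, 0, u) = 0) : ∀ t < P.T, u t = 0 := by
  have hs : ∀ t ∈ Finset.range P.T, 0 ≤
      quadB (P.stageMatrix t) (stage t ((0, 0, u) : P.Drive H)) (stage t (0, 0, u)) :=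
    fun t ht => quadB_nonneg (hcost t (Finset.mem_range.1 ht)) _
  rw [costB_apply, add_eq_zero_iff_of_nonneg (Finset.sum_nonneg hs) (quadB_nonneg hfinal _),
    Finset.sum_eq_zero_iff_of_nonneg hs] at h
  intro t
  induction t using Nat.strong_induction_on with
  | _ t ih =>
    intro ht
    -- Earlier controls vanish, hence so does the state, and only the `R t` block of the stage cost
    -- is left.
    have hx : solve t ((0, 0, u) : P.Drive H) = 0 := by
      rw [← map_zero (solve t)]
      exact solve_congr (d := (0, 0, u)) (d' := 0) rfl (fun _ _ => rfl) fun s hs => ih s hs (hs.trans ht)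
    have h0 := h.1 t (Finset.mem_range.2 ht)
    rw [stage_apply, hx] at h0
    refine eq_zero_of_quadB_posDef (hR t ht) (Eq.trans ?_ h0)
    simp only [quadB_apply, Fintype.sum_sum_type (α₁ := P.StateIdx t)]
    simp

/-- With a positive definite control cost, the optimal admissible control is unique. -/
theorem eq_of_optimal (hR : ∀ t < P.T, (P.R t).PosDef) {u u' : P.Policy H} (hu : N.IsAdm u)
    (hu' : N.IsAdm u') (hopt : ∀ v, N.IsAdm v → N.J u ≤ N.J v) (hle : N.J u' ≤ N.J u) :
    ∀ t < P.T, u' t = u t := by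
  -- Parallelogram identity: the cost form at `u' - u` is twice `J u + J u'` minus four times `J` at
  -- the midpoint, hence at most `2 (J u' - J u) ≤ 0`.
  have hm := hopt ((1 / 2 : ℝ) • (u + u')) ((hu.add hu').smul _)
  have hd : costB ((0, 0, u' - u) : P.Drive H) (0, 0, u' - u) = 0 := by
    refine le_antisymm ?_ (costB_nonneg hcost hfinal _)
    have e₁ : ((0, 0, u' - u) : P.Drive H) = (N.x₀, N.w, u') - (N.x₀, N.w, u) := by
      ext <;> simp
    have e₂ : ((N.x₀, N.w, (1 / 2 : ℝ) • (u + u')) : P.Drive H)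
        = (1 / 2 : ℝ) • ((N.x₀, N.w, u) + (N.x₀, N.w, u')) := by
      ext
      · simp only [Prod.smul_fst, Prod.fst_add, Pi.smul_apply, Pi.add_apply]
        module
      · simp only [Prod.smul_snd, Prod.snd_add, Prod.smul_fst, Prod.fst_add, Pi.smul_apply,
          Pi.add_apply]
        module
      · simp
    rw [J, J, e₂] at hm
    rw [J, J] at hle
    rw [e₁]
    have hc := costB_comm hcost hfinal (N.x₀, N.w, u') (N.x₀, N.w, u)
    simp only [map_add, map_sub, map_smul, LinearMap.add_apply, LinearMap.sub_apply,
      LinearMap.smul_apply, smul_eq_mul, hc] at hm ⊢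
    linarith
  intro t ht
  exact sub_eq_zero.1 (ctrl_eq_zero_of_costB hcost hfinal hR hd t ht)

end PosSemidef

end LinNoise

end TwoPlayerLQG

/-! ### Random vectors in `L²` and Gaussian spaces. -/

section L2

variable {Ω : Type*} [MeasurableSpace Ω] {μ : Measure Ω} {ι κ : Type*} [Fintype ι] [Fintype κ]

open Classical in
/-- The class in `L²` of a square integrable function. -/
noncomputable def toL2 (μ : Measure Ω) (X : Ω → ℝ) : Lp ℝ 2 μ :=
  if h : MemLp X 2 μ then h.toLp X else 0

/-- The classes in `L²` of the entries of a random vector. -/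
noncomputable def vecL2 {ι : Type*} (μ : Measure Ω) (X : Ω → ι → ℝ) : ι → Lp ℝ 2 μ :=
  fun i => toL2 μ fun ω => X ω i

lemma toL2_ae_eq {X : Ω → ℝ} (h : MemLp X 2 μ) : toL2 μ X =ᵐ[μ] X := by
  rw [toL2, dif_pos h]
  exact h.coeFn_toLp

lemma vecL2_ae_eq {X : Ω → ι → ℝ} (h : MemLp X 2 μ) : ∀ᵐ ω ∂μ, (fun i => vecL2 μ X i ω) = X ω := by
  have : ∀ᵐ ω ∂μ, ∀ i, vecL2 μ X i ω = X ω i :=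
    ae_all_iff.2 fun i => toL2_ae_eq (memLp_pi_iff.1 h i)
  filter_upwards [this] with ω hω
  exact funext hω

lemma vecL2_eq {X : Ω → ι → ℝ} (h : MemLp X 2 μ) {Y : ι → Lp ℝ 2 μ}
    (hY : ∀ᵐ ω ∂μ, (fun i => Y i ω) = X ω) : vecL2 μ X = Y := by
  ext1 i
  refine Lp.ext ?_
  filter_upwards [vecL2_ae_eq h, hY] with ω h₁ h₂
  exact congrFun (h₁.trans h₂.symm) i

lemma coeFn_matAct (M : Matrix κ ι ℝ) (X : ι → Lp ℝ 2 μ) :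
    ∀ᵐ ω ∂μ, (fun k => matAct M X k ω) = M *ᵥ fun i => X i ω := by
  have h : ∀ᵐ ω ∂μ, ∀ k, matAct M X k ω = ∑ i, M k i * X i ω := by
    refine ae_all_iff.2 fun k => ?_
    rw [matAct_apply]
    have h₁ : ∀ᵐ ω ∂μ, ∀ i, (M k i • X i) ω = M k i * X i ω :=
      ae_all_iff.2 fun i => Lp.coeFn_smul _ _
    filter_upwards [h₁, Lp.coeFn_finsetSum Finset.univ fun i => M k i • X i] with ω h₁ h₂
    rw [h₂, Finset.sum_apply]
    exact Finset.sum_congr rfl fun i _ => h₁ i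
  filter_upwards [h] with ω hω
  exact funext hω

lemma memLp_mulVec (M : Matrix κ ι ℝ) {X : Ω → ι → ℝ} (h : MemLp X 2 μ) :
    MemLp (fun ω => M *ᵥ X ω) 2 μ :=
  (LinearMap.toContinuousLinearMap (Matrix.mulVecLin M)).comp_memLp' h

lemma vecL2_mulVec (M : Matrix κ ι ℝ) {X : Ω → ι → ℝ} (h : MemLp X 2 μ) :
    vecL2 μ (fun ω => M *ᵥ X ω) = matAct M (vecL2 μ X) := by
  refine vecL2_eq (memLp_mulVec M h) ?_
  filter_upwards [coeFn_matAct M (vecL2 μ X), vecL2_ae_eq h] with ω h₁ h₂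
  rw [h₁, h₂]

lemma vecL2_add {X Y : Ω → ι → ℝ} (hX : MemLp X 2 μ) (hY : MemLp Y 2 μ) :
    vecL2 μ (fun ω => X ω + Y ω) = vecL2 μ X + vecL2 μ Y := by
  refine vecL2_eq (hX.add hY) ?_
  have h : ∀ᵐ ω ∂μ, ∀ i, (vecL2 μ X i + vecL2 μ Y i) ω = vecL2 μ X i ω + vecL2 μ Y i ω :=
    ae_all_iff.2 fun i => Lp.coeFn_add _ _
  filter_upwards [h, vecL2_ae_eq hX, vecL2_ae_eq hY] with ω h h₁ h₂
  ext i
  exact (h i).trans (congrArg₂ (· + ·) (congrFun h₁ i) (congrFun h₂ i))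

lemma toL2_zero : toL2 μ 0 = 0 := by
  rw [toL2, dif_pos MemLp.zero]
  exact MemLp.toLp_zero _

lemma vecL2_zero {ι : Type*} : vecL2 μ (0 : Ω → ι → ℝ) = 0 :=
  funext fun _ => toL2_zero

lemma inner_eq_integral (f g : Lp ℝ 2 μ) : inner ℝ f g = ∫ ω, f ω * g ω ∂μ := by
  rw [L2.inner_def]
  simp [mul_comm]

lemma inner_toL2 {X Y : Ω → ℝ} (hX : MemLp X 2 μ) (hY : MemLp Y 2 μ) :
    inner ℝ (toL2 μ X) (toL2 μ Y) = ∫ ω, X ω * Y ω ∂μ := by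
  rw [inner_eq_integral]
  refine integral_congr_ae ?_
  filter_upwards [toL2_ae_eq hX, toL2_ae_eq hY] with ω h₁ h₂
  rw [h₁, h₂]

lemma integrable_dotProduct_mulVec (M : Matrix ι ι ℝ) {X : Ω → ι → ℝ} (hX : MemLp X 2 μ) :
    Integrable (fun ω => X ω ⬝ᵥ (M *ᵥ X ω)) μ := by
  simp only [dotProduct]
  exact integrable_finsetSum _ fun i _ =>
    (memLp_pi_iff.1 hX i).integrable_mul (memLp_pi_iff.1 (memLp_mulVec M hX) i)

lemma integral_dotProduct_mulVec (M : Matrix ι ι ℝ) {X : Ω → ι → ℝ} (hX : MemLp X 2 μ) :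
    ∫ ω, X ω ⬝ᵥ (M *ᵥ X ω) ∂μ = quadB M (vecL2 μ X) (vecL2 μ X) := by
  have hi := memLp_pi_iff.1 hX
  simp only [quadB_apply, vecL2, inner_toL2 (hi _) (hi _), dotProduct, mulVec, Finset.mul_sum]
  have hint : ∀ i j, Integrable (fun ω => X ω i * (M i j * X ω j)) μ := fun i j =>
    (hi i).integrable_mul ((hi j).const_mul _)
  rw [integral_finsetSum _ fun i _ => integrable_finsetSum _ fun j _ => hint i j]
  refine Finset.sum_congr rfl fun i _ => ?_
  rw [integral_finsetSum _ fun j _ => hint i j]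
  refine Finset.sum_congr rfl fun j _ => ?_
  rw [← integral_const_mul]
  congr 1 with ω
  ring

/-- Finite families in `E` are jointly Gaussian with mean zero. -/
structure IsGaussianSpace (E : Submodule ℝ (Lp ℝ 2 μ)) : Prop where
  law : ∀ {κ : Type} [Fintype κ] (h : κ → Lp ℝ 2 μ), (∀ k, h k ∈ E) →
    HasGaussianLaw (fun ω k => h k ω) μ
  mean : ∀ h ∈ E, ∫ ω, h ω ∂μ = 0

namespace IsGaussianSpace

variable {E : Submodule ℝ (Lp ℝ 2 μ)} [IsProbabilityMeasure μ] (hE : IsGaussianSpace E)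
include hE

/-- An element of a Gaussian space is independent of the vectors to which it is orthogonal. -/
lemma indepFun {κ : Type} [Fintype κ] {h : κ → Lp ℝ 2 μ} (hh : ∀ k, h k ∈ E)
    {Y : Ω → κ → ℝ} (hY : ∀ᵐ ω ∂μ, (fun k => h k ω) = Y ω) {l : Lp ℝ 2 μ} (hl : l ∈ E)
    (hl' : l ∈ (Submodule.span ℝ (Set.range h))ᗮ) : IndepFun l Y μ := by
  have h₁ := hE.law (Sum.elim (fun _ : Unit => l) h) (by rintro (_ | k); exacts [hl, hh k])
  let A : ((Unit ⊕ κ) → ℝ) →L[ℝ] (Unit → ℝ) × (κ → ℝ) :=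
    (ContinuousLinearMap.pi fun i => ContinuousLinearMap.proj (Sum.inl i)).prod
      (ContinuousLinearMap.pi fun i => ContinuousLinearMap.proj (Sum.inr i))
  have h₂ : HasGaussianLaw (fun ω => (fun _ : Unit => l ω, fun k => h k ω)) μ := h₁.map_fun A
  have h₃ := HasGaussianLaw.indepFun_of_covariance_eval (X := fun _ : Unit => (l : Ω → ℝ))
    (Y := fun k => (h k : Ω → ℝ)) h₂ fun _ k => by
      rw [covariance_eq_sub (Lp.memLp _) (Lp.memLp _), hE.mean _ hl, zero_mul, sub_zero]
      have h₄ : inner ℝ l (h k) = 0 := Submodule.inner_left_of_mem_orthogonal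
        (Submodule.subset_span (Set.mem_range_self k)) hl'
      rwa [inner_eq_integral] at h₄
  have hm : Measurable fun f : Unit → ℝ => f () := measurable_pi_apply ()
  have h₅ := h₃.comp hm measurable_id
  exact h₅.congr (Filter.EventuallyEq.refl _ _) hY

/-- `U` may be any nonlinear function of `Y`: `l` is independent of it and has mean zero. This is
how nonlinear strategies become admissible controls. -/
lemma inner_eq_zero {κ : Type} [Fintype κ] {h : κ → Lp ℝ 2 μ} (hh : ∀ k, h k ∈ E)
    {Y : Ω → κ → ℝ} (hY : ∀ᵐ ω ∂μ, (fun k => h k ω) = Y ω) {l : Lp ℝ 2 μ} (hl : l ∈ E)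
    (hl' : l ∈ (Submodule.span ℝ (Set.range h))ᗮ) {U : Ω → ℝ} (hU : MemLp U 2 μ)
    (hUY : Measurable[MeasurableSpace.comap Y inferInstance] U) :
    inner ℝ (toL2 μ U) l = 0 := by
  have h₁ : IndepFun l U μ := by
    have := hE.indepFun hh hY hl hl'
    rw [IndepFun_iff_Indep] at this ⊢
    exact indep_of_indep_of_le_right this hUY.comap_le
  have h₂ : inner ℝ (toL2 μ U) l = ∫ ω, l ω * U ω ∂μ := by
    rw [inner_eq_integral]
    refine integral_congr_ae ?_
    filter_upwards [toL2_ae_eq hU] with ω hω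
    rw [hω, mul_comm]
  rw [h₂]
  have h₃ := h₁.integral_mul_eq_mul_integral (Lp.aestronglyMeasurable l) hU.aestronglyMeasurable
  rw [hE.mean l hl, zero_mul] at h₃
  exact h₃

/-- In a Gaussian space, conditional expectation is orthogonal projection. -/
lemma condExp_ae_eq {κ : Type} [Fintype κ] {h : κ → Lp ℝ 2 μ} (hh : ∀ k, h k ∈ E)
    {Y : Ω → κ → ℝ} (hYm : Measurable Y) (hY : ∀ᵐ ω ∂μ, (fun k => h k ω) = Y ω)
    {S : Submodule ℝ (Lp ℝ 2 μ)} [S.HasOrthogonalProjection]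
    (hS : S = Submodule.span ℝ (Set.range h)) {X : Ω → ℝ} (hX : MemLp X 2 μ)
    (hXE : toL2 μ X ∈ E) :
    μ[X | MeasurableSpace.pi.comap Y] =ᵐ[μ] S.starProjection (toL2 μ X) := by
  set p := S.starProjection (toL2 μ X)
  have hm := hYm.comap_le
  have hSE : S ≤ E := by
    rw [hS, Submodule.span_le]
    rintro _ ⟨k, rfl⟩
    exact hh k
  have hp : p ∈ S := Submodule.starProjection_apply_mem _ _
  -- The projection is a linear combination of the `h k`, hence almost surely a function of `Y`.
  have hpm : AEStronglyMeasurable[MeasurableSpace.pi.comap Y] p μ := by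
    rw [hS, Submodule.mem_span_range_iff_exists_fun] at hp
    obtain ⟨c, hc⟩ := hp
    refine ⟨fun ω => ∑ k, c k * Y ω k, ?_, ?_⟩
    · refine Measurable.stronglyMeasurable ?_
      have : Measurable[MeasurableSpace.pi.comap Y] Y := comap_measurable Y
      exact Finset.measurable_sum _ fun k _ =>
        ((measurable_pi_apply k).comp this).const_mul _
    · have h₁ := coeFn_matAct (Matrix.of fun _ : Unit => c) h
      filter_upwards [h₁, hY] with ω h₁ h₂
      have h₃ := congrFun h₁ ()
      rw [h₂] at h₃
      rw [← hc]
      exact h₃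
  have hl : toL2 μ X - p ∈ E := sub_mem hXE (hSE hp)
  have hl' : toL2 μ X - p ∈ (Submodule.span ℝ (Set.range h))ᗮ := by
    rw [← hS]
    exact Submodule.sub_starProjection_mem_orthogonal _
  -- The residual is independent of `Y`, so its conditional expectation is its mean, which is zero.
  have hind := (IndepFun_iff_Indep _ _ _).1 (hE.indepFun hh hY hl hl')
  have hc : μ[(toL2 μ X - p : Lp ℝ 2 μ) | MeasurableSpace.pi.comap Y] =ᵐ[μ] 0 := by
    have := condExp_indep_eq (Lp.stronglyMeasurable (toL2 μ X - p)).measurable.comap_le hm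
      (comap_measurable _).stronglyMeasurable hind
    rw [hE.mean _ hl] at this
    exact this
  have hint : ∀ g : Lp ℝ 2 μ, Integrable g μ := fun g => (Lp.memLp g).integrable (by norm_num)
  have e : X =ᵐ[μ] p + (toL2 μ X - p : Lp ℝ 2 μ) := by
    filter_upwards [toL2_ae_eq hX, Lp.coeFn_sub (toL2 μ X) p] with ω h₁ h₂
    rw [Pi.add_apply, h₂, Pi.sub_apply, h₁]
    ring
  refine (condExp_congr_ae e).trans ((condExp_add (hint _) (hint _) (MeasurableSpace.pi.comap Y)).trans ?_)
  filter_upwards [hc, condExp_of_aestronglyMeasurable' hm hpm (hint p)] with ω h₁ h₂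
  rw [Pi.add_apply, h₁, h₂, Pi.zero_apply, add_zero]

end IsGaussianSpace

/-- The span of independent centered Gaussian vectors is a Gaussian space. -/
lemma isGaussianSpace_span {o : Type*} [Finite o] {κ : o → Type} [∀ i, Fintype (κ i)]
    {X : ∀ i, Ω → κ i → ℝ} (hg : ∀ i, HasGaussianLaw (X i) μ) (hind : iIndepFun X μ)
    (hmean : ∀ i k, ∫ ω, X i ω k ∂μ = 0) :
    IsGaussianSpace
      (Submodule.span ℝ (Set.range fun p : (i : o) × κ i => vecL2 μ (X p.1) p.2)) := by
  have := Fintype.ofFinite o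
  have := hind.isProbabilityMeasure
  have hjoint := iIndepFun.hasGaussianLaw hg hind
  have hX : ∀ᵐ ω ∂μ, ∀ i, (fun k => vecL2 μ (X i) k ω) = X i ω :=
    ae_all_iff.2 fun i => vecL2_ae_eq (hg i).memLp_two
  -- Each element of the span is almost surely a linear function of the vectors `X i`, which
  -- independence makes jointly Gaussian.
  have hrep : ∀ h ∈ Submodule.span ℝ (Set.range fun p : (i : o) × κ i => vecL2 μ (X p.1) p.2),
      ∃ c : (i : o) × κ i → ℝ, ∀ᵐ ω ∂μ, h ω = ∑ p, c p * X p.1 ω p.2 := by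
    intro h hh
    obtain ⟨c, rfl⟩ := (Submodule.mem_span_range_iff_exists_fun ℝ).1 hh
    refine ⟨c, ?_⟩
    filter_upwards [coeFn_matAct (Matrix.of fun _ : Unit => c)
      (fun p : (i : o) × κ i => vecL2 μ (X p.1) p.2), hX] with ω h₁ h₂
    refine (congrFun h₁ ()).trans (Finset.sum_congr rfl fun p _ => ?_)
    have := congrFun (h₂ p.1) p.2
    simp only [Matrix.of_apply]
    rw [← this]
  refine ⟨fun {κ'} _ h hh => ?_, fun h hh => ?_⟩
  · choose c hc using fun k => hrep (h k) (hh k)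
    let A : (∀ i, κ i → ℝ) →L[ℝ] (κ' → ℝ) :=
      ContinuousLinearMap.pi fun k => ∑ p : (i : o) × κ i,
        c k p • ((ContinuousLinearMap.proj (R := ℝ) (φ := fun _ : κ p.1 => ℝ) p.2).comp
          (ContinuousLinearMap.proj (R := ℝ) (φ := fun i => κ i → ℝ) p.1))
    refine (hjoint.map_fun A).congr ?_
    filter_upwards [ae_all_iff.2 hc] with ω hω
    ext k
    rw [hω k]
    simp [A]
  · obtain ⟨c, hc⟩ := hrep h hh
    rw [integral_congr_ae hc, integral_finsetSum _ fun p _ => ?_]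
    · simp [integral_const_mul, hmean]
    · exact ((memLp_pi_iff.1 (hg p.1).memLp_two p.2).integrable (by norm_num)).const_mul _

end L2

lemma measurable_mulVec {Ω ι κ : Type*} [MeasurableSpace Ω] [Fintype ι] (M : Matrix κ ι ℝ)
    {X : Ω → ι → ℝ} (hX : Measurable X) : Measurable fun ω => M *ᵥ X ω := by
  refine measurable_pi_iff.2 fun k => ?_
  simp only [mulVec, dotProduct]
  exact Finset.measurable_sum _ fun i _ => ((measurable_pi_apply i).comp hX).const_mul _

lemma measurable_sumElim {Ω ι κ : Type*} [MeasurableSpace Ω] {X : Ω → ι → ℝ} {Y : Ω → κ → ℝ}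
    (hX : Measurable X) (hY : Measurable Y) :
    Measurable fun ω => (Sum.elim (X ω) (Y ω) : ι ⊕ κ → ℝ) :=
  measurable_pi_iff.2 fun k => match k with
    | Sum.inl i => (measurable_pi_apply i).comp hX
    | Sum.inr i => (measurable_pi_apply i).comp hY

lemma mulVec_fromBlocks_inl {ι₁ ι₂ κ₁ κ₂ : Type*} [Fintype ι₁] [Fintype ι₂]
    (a : Matrix κ₁ ι₁ ℝ) (c : Matrix κ₂ ι₁ ℝ) (d : Matrix κ₂ ι₂ ℝ) (X : ι₁ ⊕ ι₂ → ℝ) (k : κ₁) :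
    (fromBlocks a 0 c d *ᵥ X) (Sum.inl k) = (a *ᵥ (X ∘ Sum.inl)) k := by
  simp [fromBlocks_mulVec]

/-! ### The information σ-algebras do not depend on the strategies. -/

namespace TwoPlayerLQG

variable {P : TwoPlayerLQG} {Ω : Type*}

/-- The pair of strategies that never acts. -/
def zeroStrategy (P : TwoPlayerLQG) : P.Strategy := ⟨fun _ _ => 0, fun _ _ => 0⟩

lemma u_zeroStrategy (N : P.Noise Ω) (t : ℕ) : u P.zeroStrategy N t = 0 := by
  ext ω (i | i) <;> rfl

/-- The part of the state that is due to the recorded controls. -/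
def ctrlState₂ (P : TwoPlayerLQG) : ∀ t, P.Info₂ t → P.State t
  | 0, _ => 0
  | t + 1, h => P.A t *ᵥ ctrlState₂ P t (fun s => h s.castSucc) + P.B t *ᵥ (h (Fin.last t)).2

/-- The part of the first state block that is due to the recorded controls of Player 1. -/
def ctrlState₁ (P : TwoPlayerLQG) : ∀ t, P.Info₁ t → Fin (P.n₁ t) → ℝ
  | 0, _ => 0
  | t + 1, h => P.A₁₁ t *ᵥ ctrlState₁ P t (fun s => h s.castSucc) + P.B₁₁ t *ᵥ (h (Fin.last t)).2

/-- Uncontrolled measurements before time `t`. -/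
def free₂ (N : P.Noise Ω) (t : ℕ) (ω : Ω) (k : (s : Fin t) × P.MeasIdx s) : ℝ :=
  y P.zeroStrategy N k.1 ω k.2

/-- Uncontrolled measurements of Player 1 before time `t`. -/
def free₁ (N : P.Noise Ω) (t : ℕ) (ω : Ω) (k : (s : Fin t) × Fin (P.p₁ s)) : ℝ :=
  y P.zeroStrategy N k.1 ω (Sum.inl k.2)

/-- Reconstruction of the uncontrolled measurements from Player 2's information. -/
def recover₂ (P : TwoPlayerLQG) (t : ℕ) (h : P.Info₂ t) (k : (s : Fin t) × P.MeasIdx s) : ℝ :=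
  (h k.1).1 k.2 - (P.C k.1 *ᵥ ctrlState₂ P k.1 fun r => h ⟨r, r.2.trans k.1.2⟩) k.2

/-- Reconstruction of the uncontrolled measurements from Player 1's information. -/
def recover₁ (P : TwoPlayerLQG) (t : ℕ) (h : P.Info₁ t) (k : (s : Fin t) × Fin (P.p₁ s)) : ℝ :=
  (h k.1).1 k.2 - (P.C₁₁ k.1 *ᵥ ctrlState₁ P k.1 fun r => h ⟨r, r.2.trans k.1.2⟩) k.2

lemma info₁_apply (f : P.Strategy) (N : P.Noise Ω) (t : ℕ) (ω : Ω) (s : Fin t) :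
    info₁ f N t ω s = (fun i => y f N s ω (Sum.inl i), u₁ f N s ω) := by
  rw [info₁, restrict, info₂_apply]
  rfl

lemma info₂_castSucc (f : P.Strategy) (N : P.Noise Ω) (t : ℕ) (ω : Ω) :
    (fun s : Fin t => info₂ f N (t + 1) ω s.castSucc) = info₂ f N t ω := by
  funext s
  rw [info₂_apply, info₂_apply]
  rfl

lemma info₁_castSucc (f : P.Strategy) (N : P.Noise Ω) (t : ℕ) (ω : Ω) :
    (fun s : Fin t => info₁ f N (t + 1) ω s.castSucc) = info₁ f N t ω := by
  funext s
  rw [info₁_apply, info₁_apply]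
  rfl

lemma x_eq_add (f : P.Strategy) (N : P.Noise Ω) (t : ℕ) (ω : Ω) :
    x f N t ω = x P.zeroStrategy N t ω + ctrlState₂ P t (info₂ f N t ω) := by
  induction t with
  | zero => exact (add_zero (N.x₀ ω)).symm
  | succ t ih =>
    rw [x_succ, x_succ, u_zeroStrategy, ctrlState₂, info₂_castSucc, info₂_apply, ih, mulVec_add,
      Pi.zero_apply, mulVec_zero]
    simp only [Fin.val_last]
    abel

/-- The zero blocks of `A` and `B` keep Player 2's controls out of the first block, so Player 1's
own record suffices to subtract the effect of control. -/
lemma x_inl_eq_add (f : P.Strategy) (N : P.Noise Ω) (t : ℕ) (ω : Ω) :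
    x f N t ω ∘ Sum.inl
      = x P.zeroStrategy N t ω ∘ Sum.inl + ctrlState₁ P t (info₁ f N t ω) := by
  induction t with
  | zero => exact (add_zero (N.x₀ ω ∘ Sum.inl)).symm
  | succ t ih =>
    ext i
    rw [x_succ, x_succ, u_zeroStrategy, ctrlState₁, info₁_castSucc, info₁_apply]
    simp only [Function.comp_apply, Pi.add_apply, mulVec_fromBlocks_inl, ih, mulVec_add,
      Pi.zero_apply, mulVec_zero, Fin.val_last]
    have : u f N t ω ∘ Sum.inl = u₁ f N t ω := rfl
    rw [this]
    ring

lemma y_eq_add (f : P.Strategy) (N : P.Noise Ω) (t : ℕ) (ω : Ω) :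
    y f N t ω = y P.zeroStrategy N t ω + P.C t *ᵥ ctrlState₂ P t (info₂ f N t ω) := by
  rw [y, y, x_eq_add, mulVec_add]
  abel

lemma y_inl_eq_add (f : P.Strategy) (N : P.Noise Ω) (t : ℕ) (ω : Ω) (i) :
    y f N t ω (Sum.inl i) = y P.zeroStrategy N t ω (Sum.inl i)
      + (P.C₁₁ t *ᵥ ctrlState₁ P t (info₁ f N t ω)) i := by
  rw [y, y, Pi.add_apply, Pi.add_apply, mulVec_fromBlocks_inl, mulVec_fromBlocks_inl,
    x_inl_eq_add, mulVec_add, Pi.add_apply]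
  ring

lemma recover₂_info₂ (f : P.Strategy) (N : P.Noise Ω) (t : ℕ) (ω : Ω) :
    recover₂ P t (info₂ f N t ω) = free₂ N t ω := by
  ext ⟨s, i⟩
  have h : (fun r : Fin s => info₂ f N t ω ⟨r, r.2.trans s.2⟩) = info₂ f N s ω := by
    funext r
    rw [info₂_apply, info₂_apply]
  rw [recover₂, h, info₂_apply, free₂, y_eq_add]
  exact add_sub_cancel_right _ _

lemma recover₁_info₁ (f : P.Strategy) (N : P.Noise Ω) (t : ℕ) (ω : Ω) :
    recover₁ P t (info₁ f N t ω) = free₁ N t ω := by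
  ext ⟨s, i⟩
  have h : (fun r : Fin s => info₁ f N t ω ⟨r, r.2.trans s.2⟩) = info₁ f N s ω := by
    funext r
    rw [info₁_apply, info₁_apply]
  rw [recover₁, h, info₁_apply, free₁]
  simp only [y_inl_eq_add f N]
  rw [add_sub_cancel_right]

lemma measurable_ctrlState₂ (t : ℕ) : Measurable (ctrlState₂ P t) := by
  induction t with
  | zero => exact measurable_const
  | succ t ih =>
    refine (measurable_mulVec _ (ih.comp (measurable_pi_iff.2 fun s => ?_))).add
      (measurable_mulVec _ (measurable_snd.comp (measurable_pi_apply (Fin.last t))))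
    exact measurable_pi_apply s.castSucc

lemma measurable_ctrlState₁ (t : ℕ) : Measurable (ctrlState₁ P t) := by
  induction t with
  | zero => exact measurable_const
  | succ t ih =>
    refine (measurable_mulVec _ (ih.comp (measurable_pi_iff.2 fun s => ?_))).add
      (measurable_mulVec _ (measurable_snd.comp (measurable_pi_apply (Fin.last t))))
    exact measurable_pi_apply s.castSucc

lemma measurable_recover₂ (t : ℕ) : Measurable (recover₂ P t) := by
  refine measurable_pi_iff.2 fun k => ?_
  have h₁ : Measurable fun h : P.Info₂ t => (h k.1).1 k.2 :=
    (measurable_pi_apply k.2).comp (measurable_fst.comp (measurable_pi_apply k.1))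
  have h₂ : Measurable fun (h : P.Info₂ t) (r : Fin k.1) => h ⟨r, r.2.trans k.1.2⟩ :=
    measurable_pi_iff.2 fun r => measurable_pi_apply (⟨r, r.2.trans k.1.2⟩ : Fin t)
  exact h₁.sub ((measurable_pi_apply k.2).comp
    (measurable_mulVec _ ((measurable_ctrlState₂ k.1).comp h₂)))

lemma measurable_recover₁ (t : ℕ) : Measurable (recover₁ P t) := by
  refine measurable_pi_iff.2 fun k => ?_
  have h₁ : Measurable fun h : P.Info₁ t => (h k.1).1 k.2 :=
    (measurable_pi_apply k.2).comp (measurable_fst.comp (measurable_pi_apply k.1))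
  have h₂ : Measurable fun (h : P.Info₁ t) (r : Fin k.1) => h ⟨r, r.2.trans k.1.2⟩ :=
    measurable_pi_iff.2 fun r => measurable_pi_apply (⟨r, r.2.trans k.1.2⟩ : Fin t)
  exact h₁.sub ((measurable_pi_apply k.2).comp
    (measurable_mulVec _ ((measurable_ctrlState₁ k.1).comp h₂)))

section Measurability

variable [MeasurableSpace Ω] {f : P.Strategy} (hf : f.IsMeasurable) {N : P.Noise Ω}
include hf

/-- Only the uncontrolled measurements are required to be measurable, so the lemma also applies with
the σ-algebra they generate on `Ω`; this gives one inclusion in `comap_info₁`. -/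
lemma measurable_info₁ {t : ℕ} (ht : t ≤ P.T)
    (hy : ∀ s < t, Measurable fun ω i => y P.zeroStrategy N s ω (Sum.inl i)) :
    Measurable (info₁ f N t) := by
  induction t using Nat.strong_induction_on with
  | _ t ih =>
    refine measurable_pi_iff.2 fun s => ?_
    simp only [info₁_apply]
    have hs := ih s s.2 (s.2.le.trans ht) fun r hr => hy r (hr.trans s.2)
    have hm : Measurable fun ω (i : Fin (P.p₁ s)) => y f N s ω (Sum.inl i) := by
      simp only [y_inl_eq_add f N]
      exact (hy s s.2).add (measurable_mulVec _ ((measurable_ctrlState₁ s).comp hs))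
    exact hm.prodMk ((hf s (s.2.trans_le ht)).1.comp hs)

lemma measurable_info₂ {t : ℕ} (ht : t ≤ P.T)
    (hy : ∀ s < t, Measurable (y P.zeroStrategy N s)) :
    Measurable (info₂ f N t) := by
  induction t using Nat.strong_induction_on with
  | _ t ih =>
    refine measurable_pi_iff.2 fun s => ?_
    simp only [info₂_apply]
    have hs := ih s s.2 (s.2.le.trans ht) fun r hr => hy r (hr.trans s.2)
    refine Measurable.prodMk ?_ (measurable_sumElim ((hf s (s.2.trans_le ht)).1.comp
      (measurable_info₁ hf (s.2.le.trans ht) fun r hr => measurable_pi_iff.2 fun i =>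
        (measurable_pi_apply _).comp (hy r (hr.trans s.2)))) ((hf s (s.2.trans_le ht)).2.comp hs))
    rw [funext (y_eq_add f N s)]
    exact (hy s s.2).add (measurable_mulVec _ ((measurable_ctrlState₂ s).comp hs))

end Measurability

section Sigma

variable {f : P.Strategy} (hf : f.IsMeasurable) (N : P.Noise Ω)
include hf

/-- Player 1's information does not depend on the strategies. -/
lemma comap_info₁ {t : ℕ} (ht : t ≤ P.T) :
    MeasurableSpace.comap (info₁ f N t) inferInstance = MeasurableSpace.pi.comap (free₁ N t) := by
  refine le_antisymm ?_ ?_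
  · refine Measurable.comap_le (@measurable_info₁ P Ω (MeasurableSpace.pi.comap (free₁ N t))
      f hf N t ht fun s hs => ?_)
    let _ := MeasurableSpace.pi.comap (free₁ N t)
    refine measurable_pi_iff.2 fun i => ?_
    exact (measurable_pi_apply (⟨⟨s, hs⟩, i⟩ : (s : Fin t) × Fin (P.p₁ s))).comp
      (comap_measurable (free₁ N t))
  · have : free₁ N t = recover₁ P t ∘ info₁ f N t :=
      funext fun ω => (recover₁_info₁ f N t ω).symm
    rw [this, ← MeasurableSpace.comap_comp]
    exact MeasurableSpace.comap_mono (measurable_recover₁ t).comap_le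

/-- Player 2's information does not depend on the strategies. -/
lemma comap_info₂ {t : ℕ} (ht : t ≤ P.T) :
    MeasurableSpace.comap (info₂ f N t) inferInstance = MeasurableSpace.pi.comap (free₂ N t) := by
  refine le_antisymm ?_ ?_
  · refine Measurable.comap_le (@measurable_info₂ P Ω (MeasurableSpace.pi.comap (free₂ N t))
      f hf N t ht fun s hs => ?_)
    let _ := MeasurableSpace.pi.comap (free₂ N t)
    refine measurable_pi_iff.2 fun i => ?_
    exact (measurable_pi_apply (⟨⟨s, hs⟩, i⟩ : (s : Fin t) × P.MeasIdx s)).comp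
      (comap_measurable (free₂ N t))
  · have : free₂ N t = recover₂ P t ∘ info₂ f N t :=
      funext fun ω => (recover₂_info₂ f N t ω).symm
    rw [this, ← MeasurableSpace.comap_comp]
    exact MeasurableSpace.comap_mono (measurable_recover₂ t).comap_le

end Sigma

end TwoPlayerLQG

/-! ### Passage from strategies to controls in `L²`. -/

namespace TwoPlayerLQG

lemma condExp_apply_ae_eq {Ω ι : Type*} [Fintype ι] (m : MeasurableSpace Ω) {mΩ : MeasurableSpace Ω}
    {μ : Measure Ω} [IsProbabilityMeasure μ] {X : Ω → ι → ℝ} (hX : MemLp X 2 μ) :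
    ∀ᵐ ω ∂μ, ∀ i, μ[X | m] ω i = (μ[fun ω => X ω i | m]) ω :=
  ae_all_iff.2 fun i => (ContinuousLinearMap.proj (R := ℝ) (φ := fun _ : ι => ℝ) i).comp_condExp_comm
    (hX.integrable (by norm_num))

variable {P : TwoPlayerLQG} {Ω : Type*} [MeasurableSpace Ω] {μ : Measure Ω}

/-- Index types of the primitive random vectors. -/
def NoiseIdx (P : TwoPlayerLQG) : Option (Fin P.T) → Type
  | none => P.StateIdx 0
  | some t => P.StateIdx (t + 1) ⊕ P.MeasIdx t

instance : ∀ o, Fintype (P.NoiseIdx o)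
  | none => inferInstanceAs (Fintype (P.StateIdx 0))
  | some t => inferInstanceAs (Fintype (P.StateIdx (t + 1) ⊕ P.MeasIdx t))

/-- The primitive random vectors as one family. -/
def noiseVec (N : P.Noise Ω) : ∀ o, Ω → P.NoiseIdx o → ℝ
  | none => N.x₀
  | some t => fun ω => Sum.elim (N.w t ω) (N.v t ω)

/-- The span of the primitive random vectors in `L²`. -/
def noiseSpace (N : P.Noise Ω) (μ : Measure Ω) : Submodule ℝ (Lp ℝ 2 μ) :=
  Submodule.span ℝ (Set.range fun p : (o : Option (Fin P.T)) × P.NoiseIdx o =>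
    vecL2 μ (noiseVec N p.1) p.2)

open Classical in
/-- The primitive random vectors with entries in `L²`. -/
noncomputable def linNoise (N : P.Noise Ω) (μ : Measure Ω) : P.LinNoise (Lp ℝ 2 μ) where
  x₀ := vecL2 μ N.x₀
  -- Nothing is assumed about the noise from the horizon on; the value zero keeps `IsWhite` true at
  -- all times.
  w t := if t < P.T then vecL2 μ (N.w t) else 0
  v t := if t < P.T then vecL2 μ (N.v t) else 0

/-- The controls of a pair of strategies with entries in `L²`. -/
noncomputable def ctrlL2 (f : P.Strategy) (N : P.Noise Ω) (μ : Measure Ω) :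
    P.Policy (Lp ℝ 2 μ) :=
  fun t => if t < P.T then vecL2 μ (u f N t) else 0

lemma noiseVec_mem (N : P.Noise Ω) (o) (k) : vecL2 μ (noiseVec N o) k ∈ noiseSpace N μ :=
  Submodule.subset_span ⟨⟨o, k⟩, rfl⟩

section

variable {N : P.Noise Ω}

lemma past_le_noiseSpace (t : ℕ) : (linNoise N μ).past t ≤ noiseSpace N μ := by
  induction t with
  | zero =>
    refine Submodule.span_le.2 ?_
    rintro _ ⟨i, rfl⟩
    exact noiseVec_mem N none i
  | succ t ih =>
    refine sup_le (sup_le ih (Submodule.span_le.2 ?_)) (Submodule.span_le.2 ?_)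
    · rintro _ ⟨i, rfl⟩
      by_cases h : t < P.T
      · simp only [linNoise, h, if_true]
        exact noiseVec_mem N (some ⟨t, h⟩) (Sum.inl i)
      · simp [linNoise, h]
    · rintro _ ⟨i, rfl⟩
      by_cases h : t < P.T
      · simp only [linNoise, h, if_true]
        exact noiseVec_mem N (some ⟨t, h⟩) (Sum.inr i)
      · simp [linNoise, h]

lemma ctrlL2_zeroStrategy : ctrlL2 P.zeroStrategy N μ = 0 := by
  funext t
  by_cases h : t < P.T
  · rw [ctrlL2, if_pos h, u_zeroStrategy]
    exact vecL2_zero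
  · exact if_neg h

lemma memLp_u_zeroStrategy (t : ℕ) : MemLp (u P.zeroStrategy N t) 2 μ := by
  rw [u_zeroStrategy]
  exact MemLp.zero

lemma ybar_mem_noiseSpace (t : ℕ) (i) : (linNoise N μ).ybar t i ∈ noiseSpace N μ :=
  past_le_noiseSpace (t + 1) (LinNoise.ybar_mem_past _ t i)

end

namespace Noise.IsValid

variable {N : P.Noise Ω} (hN : N.IsValid μ)
include hN

lemma hasGaussianLaw_noiseVec : ∀ o, HasGaussianLaw (noiseVec N o) μ
  | none => hN.init.gaussian
  | some t => (hN.noise t t.2).gaussian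

lemma integral_noiseVec : ∀ o k, ∫ ω, noiseVec N o ω k ∂μ = 0
  | none => hN.init.mean
  | some t => (hN.noise t t.2).mean

lemma iIndepFun_noiseVec : iIndepFun (noiseVec N) μ := by
  rw [iIndepFun_iff_iIndep]
  convert hN.indep using 2 with o
  cases o <;> rfl

lemma isGaussianSpace : IsGaussianSpace (noiseSpace N μ) :=
  isGaussianSpace_span hN.hasGaussianLaw_noiseVec hN.iIndepFun_noiseVec hN.integral_noiseVec

lemma memLp_noiseVec (o) : MemLp (noiseVec N o) 2 μ :=
  (hN.hasGaussianLaw_noiseVec o).memLp_two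

lemma memLp_w {t : ℕ} (ht : t < P.T) : MemLp (N.w t) 2 μ :=
  memLp_pi_iff.2 fun i => memLp_pi_iff.1 (hN.memLp_noiseVec (some ⟨t, ht⟩)) (Sum.inl i)

lemma memLp_v {t : ℕ} (ht : t < P.T) : MemLp (N.v t) 2 μ :=
  memLp_pi_iff.2 fun i => memLp_pi_iff.1 (hN.memLp_noiseVec (some ⟨t, ht⟩)) (Sum.inr i)

lemma measurable_w {t : ℕ} (ht : t < P.T) : Measurable (N.w t) :=
  measurable_pi_iff.2 fun i =>
    (measurable_pi_apply (Sum.inl i)).comp (hN.noise t ht).measurable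

lemma measurable_v {t : ℕ} (ht : t < P.T) : Measurable (N.v t) :=
  measurable_pi_iff.2 fun i =>
    (measurable_pi_apply (Sum.inr i)).comp (hN.noise t ht).measurable

lemma inner_noiseVec {o o'} (h : o ≠ o') (k k') :
    inner ℝ (vecL2 μ (noiseVec N o) k) (vecL2 μ (noiseVec N o') k') = 0 := by
  have h₁ := memLp_pi_iff.1 (hN.memLp_noiseVec o) k
  have h₂ := memLp_pi_iff.1 (hN.memLp_noiseVec o') k'
  have hi : IndepFun (fun ω => noiseVec N o ω k) (fun ω => noiseVec N o' ω k') μ :=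
    (hN.iIndepFun_noiseVec.indepFun h).comp (measurable_pi_apply k) (measurable_pi_apply k')
  refine (inner_toL2 h₁ h₂).trans ((hi.integral_mul_eq_mul_integral h₁.aestronglyMeasurable
    h₂.aestronglyMeasurable).trans ?_)
  rw [hN.integral_noiseVec, zero_mul]

lemma noiseVec_mem_orthogonal {t : ℕ} (s : Fin P.T) (hts : t ≤ s) (k) :
    vecL2 μ (noiseVec N (some s)) k ∈ ((linNoise N μ).past t)ᗮ := by
  induction t with
  | zero =>
    exact mem_orthogonal_span_range fun i =>
      hN.inner_noiseVec (o := some s) (o' := none) (by simp) k i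
  | succ t ih =>
    have ht : t < P.T := (Nat.lt_of_succ_le hts).trans s.2
    have hne : some s ≠ some ⟨t, ht⟩ := by
      intro h
      have := congrArg Fin.val (Option.some.inj h)
      simp only at this
      omega
    rw [LinNoise.past, ← Submodule.inf_orthogonal, ← Submodule.inf_orthogonal]
    refine ⟨⟨ih (by omega), ?_⟩, ?_⟩
    · refine mem_orthogonal_span_range fun i => ?_
      simp only [linNoise, ht, if_true]
      exact hN.inner_noiseVec hne k (Sum.inl i)
    · refine mem_orthogonal_span_range fun i => ?_
      simp only [linNoise, ht, if_true]
      exact hN.inner_noiseVec hne k (Sum.inr i)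

lemma isWhite : (linNoise N μ).IsWhite := by
  intro t
  by_cases h : t < P.T
  · simp only [linNoise, h, if_true]
    exact ⟨fun i => hN.noiseVec_mem_orthogonal ⟨t, h⟩ le_rfl (Sum.inl i),
      fun i => hN.noiseVec_mem_orthogonal ⟨t, h⟩ le_rfl (Sum.inr i)⟩
  · simp [linNoise, h]

/-- States are square integrable and correspond to the abstract state process. -/
lemma memLp_x_and_vecL2_x {f : P.Strategy} {t : ℕ} (hu : ∀ s < t, MemLp (u f N s) 2 μ)
    (ht : t ≤ P.T) :
    MemLp (x f N t) 2 μ ∧ vecL2 μ (x f N t) = (linNoise N μ).state (ctrlL2 f N μ) t := by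
  induction t with
  | zero => exact ⟨hN.memLp_noiseVec none, rfl⟩
  | succ t ih =>
    obtain ⟨h₁, h₂⟩ := ih (fun s hs => hu s (hs.trans t.lt_succ_self)) (Nat.le_of_succ_le ht)
    have hA := memLp_mulVec (P.A t) h₁
    have hB := memLp_mulVec (P.B t) (hu t t.lt_succ_self)
    have hw := hN.memLp_w (Nat.lt_of_succ_le ht)
    refine ⟨(hA.add hB).add hw, ?_⟩
    rw [LinNoise.state_succ, ← h₂]
    have hw' : (linNoise N μ).w t = vecL2 μ (N.w t) := if_pos (Nat.lt_of_succ_le ht)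
    have hu' : ctrlL2 f N μ t = vecL2 μ (u f N t) := if_pos (Nat.lt_of_succ_le ht)
    rw [hw', hu', ← vecL2_mulVec _ h₁, ← vecL2_mulVec _ (hu t t.lt_succ_self), ← vecL2_add hA hB]
    exact vecL2_add (hA.add hB) hw

lemma memLp_y_and_vecL2_y {t : ℕ} (ht : t < P.T) :
    MemLp (y P.zeroStrategy N t) 2 μ ∧
      vecL2 μ (y P.zeroStrategy N t) = (linNoise N μ).ybar t := by
  obtain ⟨h₁, h₂⟩ := hN.memLp_x_and_vecL2_x (f := P.zeroStrategy)
    (fun s _ => memLp_u_zeroStrategy s) ht.le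
  have hC := memLp_mulVec (P.C t) h₁
  refine ⟨hC.add (hN.memLp_v ht), ?_⟩
  have hv : (linNoise N μ).v t = vecL2 μ (N.v t) := if_pos ht
  rw [LinNoise.ybar, ← ctrlL2_zeroStrategy (N := N) (μ := μ), ← h₂, hv, ← vecL2_mulVec _ h₁]
  exact vecL2_add hC (hN.memLp_v ht)

lemma ybar_ae_eq_free₂ {t : ℕ} (ht : t ≤ P.T) :
    ∀ᵐ ω ∂μ, (fun k : (s : Fin t) × P.MeasIdx s => (linNoise N μ).ybar k.1 k.2 ω)
      = free₂ N t ω := by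
  have h : ∀ᵐ ω ∂μ, ∀ s : Fin t, (fun i => (linNoise N μ).ybar s i ω)
      = y P.zeroStrategy N s ω := by
    refine ae_all_iff.2 fun s => ?_
    obtain ⟨h₁, h₂⟩ := hN.memLp_y_and_vecL2_y (s.2.trans_le ht)
    rw [← h₂]
    exact vecL2_ae_eq h₁
  filter_upwards [h] with ω hω
  ext ⟨s, i⟩
  exact congrFun (hω s) i

lemma ybar_ae_eq_free₁ {t : ℕ} (ht : t ≤ P.T) :
    ∀ᵐ ω ∂μ, (fun k : (s : Fin t) × Fin (P.p₁ s) => (linNoise N μ).ybar k.1 (Sum.inl k.2) ω)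
      = free₁ N t ω := by
  filter_upwards [hN.ybar_ae_eq_free₂ ht] with ω hω
  ext ⟨s, i⟩
  exact congrFun hω ⟨s, Sum.inl i⟩

lemma measurable_x {f : P.Strategy} {t : ℕ} (ht : t ≤ P.T)
    (hu : ∀ s < t, Measurable (u f N s)) : Measurable (x f N t) := by
  induction t with
  | zero => exact hN.init.measurable
  | succ t ih =>
    have h₁ := ih (Nat.le_of_succ_le ht) fun s hs => hu s (hs.trans t.lt_succ_self)
    exact ((measurable_mulVec _ h₁).add (measurable_mulVec _ (hu t t.lt_succ_self))).add
      (hN.measurable_w (Nat.lt_of_succ_le ht))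

lemma measurable_y_zeroStrategy {t : ℕ} (ht : t < P.T) : Measurable (y P.zeroStrategy N t) := by
  refine (measurable_mulVec _ (hN.measurable_x ht.le fun s _ => ?_)).add (hN.measurable_v ht)
  rw [u_zeroStrategy]
  exact measurable_const

lemma measurable_free₂ {t : ℕ} (ht : t ≤ P.T) : Measurable (free₂ N t) :=
  measurable_pi_iff.2 fun k => (measurable_pi_apply k.2).comp
    (hN.measurable_y_zeroStrategy (k.1.2.trans_le ht))

lemma measurable_free₁ {t : ℕ} (ht : t ≤ P.T) : Measurable (free₁ N t) :=
  measurable_pi_iff.2 fun k => (measurable_pi_apply (Sum.inl k.2)).comp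
    (hN.measurable_y_zeroStrategy (k.1.2.trans_le ht))

lemma measurable_u {f : P.Strategy} (hf : f.IsMeasurable) {t : ℕ} (ht : t < P.T) :
    Measurable (u f N t) := by
  have h₂ := measurable_info₂ (N := N) hf ht.le fun s hs =>
    hN.measurable_y_zeroStrategy (hs.trans ht)
  have h₁ := measurable_info₁ (N := N) hf ht.le fun s hs => measurable_pi_iff.2 fun i =>
    (measurable_pi_apply (Sum.inl i)).comp (hN.measurable_y_zeroStrategy (hs.trans ht))
  exact measurable_sumElim ((hf t ht).1.comp h₁) ((hf t ht).2.comp h₂)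

section Prob

variable [IsProbabilityMeasure μ]

/-- The controls are functions of the uncontrolled measurements, which are Gaussian and span `G t`
and `F t`; noise orthogonal to these is independent of the control. -/
lemma isAdm_ctrlL2 {f : P.Strategy} (hf : f.IsMeasurable) (hu : FiniteSecondMoments f N μ) :
    (linNoise N μ).IsAdm (ctrlL2 f N μ) := by
  intro t n h hh
  have hE := past_le_noiseSpace n hh
  by_cases ht : t < P.T
  · have hm := memLp_pi_iff.1 (hu t ht)
    simp only [ctrlL2, ht, if_true]
    refine ⟨fun hG i => ?_, fun hF i => ?_⟩
    · refine hN.isGaussianSpace.inner_eq_zero (fun k => ybar_mem_noiseSpace _ _)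
        (hN.ybar_ae_eq_free₁ ht.le) hE hG (hm (Sum.inl i)) ?_
      rw [← comap_info₁ hf N ht.le]
      let _ := MeasurableSpace.pi.comap (info₁ f N t)
      exact (measurable_pi_apply i).comp ((hf t ht).1.comp (comap_measurable (info₁ f N t)))
    · refine hN.isGaussianSpace.inner_eq_zero (fun k => ybar_mem_noiseSpace _ _)
        (hN.ybar_ae_eq_free₂ ht.le) hE hF (hm (Sum.inr i)) ?_
      rw [← comap_info₂ hf N ht.le]
      let _ := MeasurableSpace.pi.comap (info₂ f N t)
      exact (measurable_pi_apply i).comp ((hf t ht).2.comp (comap_measurable (info₂ f N t)))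
  · simp [ctrlL2, ht]

lemma zhat_ae_eq {f : P.Strategy} (hf : f.IsMeasurable) {t : ℕ} (ht : t < P.T)
    (hx : MemLp (x f N t) 2 μ) (hxE : ∀ i, vecL2 μ (x f N t) i ∈ noiseSpace N μ) :
    ∀ᵐ ω ∂μ, (fun i => projT ((linNoise N μ).G t) (vecL2 μ (x f N t)) i ω) = zhat f N μ t ω := by
  have h₁ : ∀ᵐ ω ∂μ, ∀ i, (μ[fun ω => x f N t ω i | MeasurableSpace.pi.comap (free₁ N t)]) ω
      = projT ((linNoise N μ).G t) (vecL2 μ (x f N t)) i ω :=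
    ae_all_iff.2 fun i => hN.isGaussianSpace.condExp_ae_eq (S := (linNoise N μ).G t)
      (fun k => ybar_mem_noiseSpace _ _) (hN.measurable_free₁ ht.le)
      (hN.ybar_ae_eq_free₁ ht.le) rfl (memLp_pi_iff.1 hx i) (hxE i)
  filter_upwards [h₁, condExp_apply_ae_eq (MeasurableSpace.pi.comap (free₁ N t)) hx] with ω h₁ h₂
  ext i
  rw [zhat, comap_info₁ hf N ht.le, h₂, h₁]

lemma z_ae_eq {f : P.Strategy} (hf : f.IsMeasurable) {t : ℕ} (ht : t < P.T)
    (hx : MemLp (x f N t) 2 μ) (hxE : ∀ i, vecL2 μ (x f N t) i ∈ noiseSpace N μ) :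
    ∀ᵐ ω ∂μ, (fun i => projT ((linNoise N μ).F t) (vecL2 μ (x f N t)) i ω) = z f N μ t ω := by
  have h₁ : ∀ᵐ ω ∂μ, ∀ i, (μ[fun ω => x f N t ω i | MeasurableSpace.pi.comap (free₂ N t)]) ω
      = projT ((linNoise N μ).F t) (vecL2 μ (x f N t)) i ω :=
    ae_all_iff.2 fun i => hN.isGaussianSpace.condExp_ae_eq (S := (linNoise N μ).F t)
      (fun k => ybar_mem_noiseSpace _ _) (hN.measurable_free₂ ht.le)
      (hN.ybar_ae_eq_free₂ ht.le) rfl (memLp_pi_iff.1 hx i) (hxE i)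
  filter_upwards [h₁, condExp_apply_ae_eq (MeasurableSpace.pi.comap (free₂ N t)) hx] with ω h₁ h₂
  ext i
  rw [z, comap_info₂ hf N ht.le, h₂, h₁]

end Prob

end Noise.IsValid

end TwoPlayerLQG

/-! ### Cost, integrability, and realization of linear controls by strategies. -/

namespace TwoPlayerLQG

variable {P : TwoPlayerLQG}

lemma stageCost_nonneg {Ω : Type*} (hcost : ∀ t < P.T, (P.stageMatrix t).PosSemidef)
    (f : P.Strategy) (N : P.Noise Ω) (ω : Ω) {t : ℕ} (ht : t ∈ Finset.range P.T) :
    0 ≤ Sum.elim (x f N t ω) (u f N t ω) ⬝ᵥ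
      (P.stageMatrix t *ᵥ Sum.elim (x f N t ω) (u f N t ω)) :=
  (hcost t (Finset.mem_range.1 ht)).dotProduct_mulVec_nonneg _

lemma pathCost_nonneg {Ω : Type*} (hcost : ∀ t < P.T, (P.stageMatrix t).PosSemidef)
    (hfinal : P.Pfinal.PosSemidef) (f : P.Strategy) (N : P.Noise Ω) (ω : Ω) :
    0 ≤ pathCost f N ω :=
  add_nonneg (Finset.sum_nonneg fun _ ht => stageCost_nonneg hcost f N ω ht)
    (hfinal.dotProduct_mulVec_nonneg _)

lemma stageCost_le_pathCost {Ω : Type*} (hcost : ∀ t < P.T, (P.stageMatrix t).PosSemidef)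
    (hfinal : P.Pfinal.PosSemidef) (f : P.Strategy) (N : P.Noise Ω) (ω : Ω) {t : ℕ}
    (ht : t < P.T) :
    Sum.elim (x f N t ω) (u f N t ω) ⬝ᵥ
      (P.stageMatrix t *ᵥ Sum.elim (x f N t ω) (u f N t ω)) ≤ pathCost f N ω := by
  have h := Finset.single_le_sum
    (fun s hs => stageCost_nonneg hcost f N ω hs) (Finset.mem_range.2 ht)
  exact h.trans (le_add_of_nonneg_right (hfinal.dotProduct_mulVec_nonneg _))

variable {Ω : Type*} [MeasurableSpace Ω] {μ : Measure Ω}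

lemma memLp_sumElim {ι κ : Type*} [Fintype ι] [Fintype κ] {X : Ω → ι → ℝ} {Y : Ω → κ → ℝ}
    (hX : MemLp X 2 μ) (hY : MemLp Y 2 μ) :
    MemLp (fun ω => (Sum.elim (X ω) (Y ω) : ι ⊕ κ → ℝ)) 2 μ :=
  memLp_pi_iff.2 fun k => match k with
    | Sum.inl i => memLp_pi_iff.1 hX i
    | Sum.inr i => memLp_pi_iff.1 hY i

namespace Noise.IsValid

variable {N : P.Noise Ω} (hN : N.IsValid μ)
include hN

lemma cost_eq (hcost : ∀ t < P.T, (P.stageMatrix t).PosSemidef) (hfinal : P.Pfinal.PosSemidef)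
    {f : P.Strategy} (hu : FiniteSecondMoments f N μ) :
    cost f N μ = ENNReal.ofReal ((linNoise N μ).J (ctrlL2 f N μ)) := by
  have hx := fun (t : ℕ) (ht : t ≤ P.T) =>
    hN.memLp_x_and_vecL2_x (fun s hs => hu s (hs.trans_le ht)) ht
  have hst : ∀ t ∈ Finset.range P.T, MemLp (fun ω => Sum.elim (x f N t ω) (u f N t ω)) 2 μ :=
    fun t ht => memLp_sumElim (hx t (Finset.mem_range.1 ht).le).1 (hu t (Finset.mem_range.1 ht))
  have hi₁ := fun t ht => integrable_dotProduct_mulVec (P.stageMatrix t) (hst t ht)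
  have hi₂ := integrable_dotProduct_mulVec P.Pfinal (hx P.T le_rfl).1
  have hint : Integrable (pathCost f N) μ := (integrable_finsetSum _ hi₁).add hi₂
  rw [cost, ← ofReal_integral_eq_lintegral_ofReal hint
    (Filter.Eventually.of_forall (pathCost_nonneg hcost hfinal f N))]
  congr 1
  simp only [pathCost]
  rw [integral_add (integrable_finsetSum _ hi₁) hi₂, integral_finsetSum _ hi₁, LinNoise.J,
    costB_apply, integral_dotProduct_mulVec _ (hx P.T le_rfl).1, (hx P.T le_rfl).2]
  congr 1
  refine Finset.sum_congr rfl fun t ht => ?_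
  have e : vecL2 μ (fun ω => Sum.elim (x f N t ω) (u f N t ω))
      = stage t ((linNoise N μ).x₀, (linNoise N μ).w, ctrlL2 f N μ) := by
    have h₁ := (hx t (Finset.mem_range.1 ht).le).2
    have h₂ : ctrlL2 f N μ t = vecL2 μ (u f N t) := if_pos (Finset.mem_range.1 ht)
    ext1 (i | i)
    · exact congrFun h₁ i
    · exact (congrFun h₂ i).symm
  rw [integral_dotProduct_mulVec _ (hst t ht), e]

/-- With a positive definite control cost, controls of finite cost are square integrable. -/
lemma finiteSecondMoments_of_cost_ne_top (hcost : ∀ t < P.T, (P.stageMatrix t).PosSemidef)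
    (hfinal : P.Pfinal.PosSemidef) (hR : ∀ t < P.T, (P.R t).PosDef) {f : P.Strategy}
    (hf : f.IsMeasurable) (hfin : cost f N μ ≠ ∞) : FiniteSecondMoments f N μ := by
  classical
  intro t
  induction t using Nat.strong_induction_on with
  | _ t ih =>
    intro ht
    have hx := (hN.memLp_x_and_vecL2_x (fun s hs => ih s hs (hs.trans ht)) ht.le).1
    have hum := hN.measurable_u hf ht
    have hxm := hN.measurable_x ht.le fun s hs => hN.measurable_u hf (hs.trans ht)
    obtain ⟨L, hL, -⟩ := exists_quadB_eq (H := ℝ) (hcost t ht)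
    set X : Ω → P.StateIdx t ⊕ P.CtrlIdx t → ℝ := fun ω => Sum.elim (x f N t ω) (u f N t ω)
    have hXm : Measurable X := measurable_sumElim hxm hum
    -- With the stage matrix equal to `Lᵀ * L`, the stage cost is the sum of squares of the entries
    -- of `L *ᵥ X`.
    have hle : ∀ ω k, (L *ᵥ X ω) k ^ 2 ≤ pathCost f N ω := by
      intro ω k
      refine le_trans ?_ (stageCost_le_pathCost hcost hfinal f N ω ht)
      have e : X ω ⬝ᵥ (P.stageMatrix t *ᵥ X ω) = ∑ k, (L *ᵥ X ω) k ^ 2 := by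
        rw [hL, ← mulVec_mulVec, dotProduct_mulVec, vecMul_transpose, dotProduct]
        exact Finset.sum_congr rfl fun k _ => (sq _).symm
      rw [e]
      exact Finset.single_le_sum (f := fun k => (L *ᵥ X ω) k ^ 2) (fun _ _ => sq_nonneg _)
        (Finset.mem_univ k)
    have hLX : MemLp (fun ω => L *ᵥ X ω) 2 μ := by
      refine memLp_pi_iff.2 fun k => ?_
      have hm : Measurable fun ω => (L *ᵥ X ω) k :=
        (measurable_pi_apply k).comp (measurable_mulVec L hXm)
      refine (memLp_two_iff_integrable_sq hm.aestronglyMeasurable).2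
        ⟨(hm.pow_const 2).aestronglyMeasurable, ?_⟩
      rw [hasFiniteIntegral_iff_ofReal (Filter.Eventually.of_forall fun ω => sq_nonneg _)]
      exact (lintegral_mono fun ω => ENNReal.ofReal_le_ofReal (hle ω k)).trans_lt
        (lt_top_iff_ne_top.2 hfin)
    have hMX : MemLp (fun ω => P.stageMatrix t *ᵥ X ω) 2 μ := by
      have := memLp_mulVec Lᵀ hLX
      rw [hL]
      simpa only [mulVec_mulVec] using this
    -- The lower block of the stage matrix applied to `X` is `Sᵀ x + R u`, and the state is square
    -- integrable by induction.
    have hRu : MemLp (fun ω => P.R t *ᵥ u f N t ω) 2 μ := by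
      have h₁ : MemLp (fun ω i => (P.stageMatrix t *ᵥ X ω) (Sum.inr i)) 2 μ :=
        memLp_pi_iff.2 fun i => memLp_pi_iff.1 hMX (Sum.inr i)
      have h₂ := h₁.sub (memLp_mulVec (P.S t)ᵀ hx)
      refine (memLp_congr_ae (Filter.Eventually.of_forall fun ω => ?_)).1 h₂
      ext i
      simp [X, fromBlocks_mulVec]
    have h := memLp_mulVec (P.R t)⁻¹ hRu
    refine (memLp_congr_ae (Filter.Eventually.of_forall fun ω => ?_)).1 h
    simp only [mulVec_mulVec]
    rw [Matrix.nonsing_inv_mul _ ((Matrix.isUnit_iff_isUnit_det _).1 (hR t ht).isUnit), one_mulVec]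

/-- Linear control processes are realized by strategies. -/
lemma exists_strategy {v : P.Policy (Lp ℝ 2 μ)} (hv : (linNoise N μ).IsLin v) :
    ∃ f : P.Strategy, f.IsMeasurable ∧ FiniteSecondMoments f N μ ∧
      ∀ t < P.T, ctrlL2 f N μ t = v t := by
  choose c₁ hc₁ using fun t i => (Submodule.mem_span_range_iff_exists_fun ℝ).1 ((hv t).1 i)
  choose c₂ hc₂ using fun t i => (Submodule.mem_span_range_iff_exists_fun ℝ).1 ((hv t).2 i)
  let M₁ : ∀ t, Matrix (Fin (P.m₁ t)) ((s : Fin t) × Fin (P.p₁ s)) ℝ := fun t => Matrix.of (c₁ t)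
  let M₂ : ∀ t, Matrix (Fin (P.m₂ t)) ((s : Fin t) × P.MeasIdx s) ℝ := fun t => Matrix.of (c₂ t)
  -- The coefficients refer to uncontrolled measurements, so each player first reconstructs these
  -- from the record.
  let f : P.Strategy := ⟨fun t h => M₁ t *ᵥ recover₁ P t h, fun t h => M₂ t *ᵥ recover₂ P t h⟩
  have hf : f.IsMeasurable := fun t _ => ⟨measurable_mulVec _ (measurable_recover₁ t),
    measurable_mulVec _ (measurable_recover₂ t)⟩
  have hae : ∀ t < P.T, ∀ᵐ ω ∂μ, (fun i => v t i ω) = u f N t ω := by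
    intro t ht
    filter_upwards [coeFn_matAct (M₁ t) fun k => (linNoise N μ).ybar k.1 (Sum.inl k.2),
      coeFn_matAct (M₂ t) fun k => (linNoise N μ).ybar k.1 k.2,
      hN.ybar_ae_eq_free₁ ht.le, hN.ybar_ae_eq_free₂ ht.le] with ω h₁ h₂ h₃ h₄
    have e₁ : u₁ f N t ω = M₁ t *ᵥ free₁ N t ω := by rw [← recover₁_info₁ f]; rfl
    have e₂ : u₂ f N t ω = M₂ t *ᵥ free₂ N t ω := by rw [← recover₂_info₂ f]; rfl
    rw [h₃, ← e₁] at h₁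
    rw [h₄, ← e₂] at h₂
    ext (i | i)
    · rw [← hc₁ t i]
      exact congrFun h₁ i
    · rw [← hc₂ t i]
      exact congrFun h₂ i
  have hm : ∀ t < P.T, MemLp (u f N t) 2 μ := by
    intro t ht
    have h : MemLp (fun ω i => v t i ω) 2 μ := memLp_pi_iff.2 fun i => Lp.memLp (v t i)
    exact (memLp_congr_ae (hae t ht)).1 h
  refine ⟨f, hf, hm, fun t ht => ?_⟩
  rw [ctrlL2, if_pos ht]
  exact vecL2_eq (hm t ht) (hae t ht)

/-- Strategies that realize gains on the estimates have the corresponding form. -/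
lemma hasForm [IsProbabilityMeasure μ] {v : P.Policy (Lp ℝ 2 μ)}
    {K L : ∀ t, Matrix (P.CtrlIdx t) (P.StateIdx t) ℝ} (hv : (linNoise N μ).IsLin v)
    (hg : (linNoise N μ).HasGains v K L) (hL : ∀ t i j, L t (Sum.inl i) j = 0)
    {f : P.Strategy} (hf : f.IsMeasurable) (hu : FiniteSecondMoments f N μ)
    (hfv : ∀ t < P.T, ctrlL2 f N μ t = v t) :
    HasForm f N μ (fun t => (K t).submatrix Sum.inl id)
      (fun t => (K t - L t).submatrix Sum.inr id) (fun t => (L t).submatrix Sum.inr id) := by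
  intro t ht
  obtain ⟨hx, hx'⟩ := hN.memLp_x_and_vecL2_x (fun s hs => hu s (hs.trans ht)) ht.le
  have hst : vecL2 μ (x f N t) = (linNoise N μ).state v t :=
    hx'.trans (solve_congr (d := (_, _, ctrlL2 f N μ)) (d' := (_, _, v)) rfl (fun _ _ => rfl) fun s hs => hfv s (hs.trans ht))
  have hxE : ∀ i, vecL2 μ (x f N t) i ∈ noiseSpace N μ := fun i => by
    rw [hst]
    exact past_le_noiseSpace t (LinNoise.state_mem_past _
      (fun s j => LinNoise.F_le_past _ s (hv.mem_F s j)) t i)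
  have hz₁ := hN.zhat_ae_eq hf ht hx hxE
  have hz₂ := hN.z_ae_eq hf ht hx hxE
  rw [hst] at hz₁ hz₂
  -- The gap is the difference of the estimates; in Player 1's rows `L` vanishes, so there only `K`
  -- acts, on Player 1's estimate.
  have hgt : v t = matAct (K t - L t) ((linNoise N μ).est₁ v t)
      + matAct (L t) ((linNoise N μ).est₂ v t) := by
    rw [hg t, LinNoise.gap, matAct_sub_left, map_sub]
    abel
  have hu' : ∀ᵐ ω ∂μ, (fun i => v t i ω) = u f N t ω := by
    rw [← hfv t ht, ctrlL2, if_pos ht]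
    exact vecL2_ae_eq (hu t ht)
  have hadd : ∀ᵐ ω ∂μ, ∀ i, v t i ω = matAct (K t - L t) ((linNoise N μ).est₁ v t) i ω
      + matAct (L t) ((linNoise N μ).est₂ v t) i ω := by
    refine ae_all_iff.2 fun i => ?_
    rw [hgt]
    exact Lp.coeFn_add _ _
  filter_upwards [hz₁, hz₂, hu', hadd, coeFn_matAct (K t - L t) ((linNoise N μ).est₁ v t),
    coeFn_matAct (L t) ((linNoise N μ).est₂ v t)] with ω h₁ h₂ h₃ h₄ h₅ h₆
  have e : u f N t ω = (K t - L t) *ᵥ zhat f N μ t ω + L t *ᵥ z f N μ t ω := by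
    rw [← h₁, ← h₂, ← h₃]
    ext i
    exact (h₄ i).trans (congrArg₂ (· + ·) (congrFun h₅ i) (congrFun h₆ i))
  refine ⟨?_, ?_⟩
  · ext i
    refine (congrFun e (Sum.inl i)).trans ?_
    simp only [Pi.add_apply, mulVec, dotProduct, Matrix.sub_apply, hL, submatrix_apply, id_eq]
    simp
  · ext i
    exact congrFun e (Sum.inr i)

end Noise.IsValid

end TwoPlayerLQG

/-! ### The theorem. -/

theorem mainTheorem2 (P : TwoPlayerLQG) {Ω : Type*} [MeasurableSpace Ω] (μ : Measure Ω)
    [IsProbabilityMeasure μ] (N : P.Noise Ω) (hN : N.IsValid μ)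
    (hcost : ∀ t < P.T, (P.stageMatrix t).PosSemidef) (hfinal : P.Pfinal.PosSemidef) :
    (∃ G H₁ H₂, ∃ f : P.Strategy,
      TwoPlayerLQG.IsOptimalL2 f N μ ∧ TwoPlayerLQG.HasForm f N μ G H₁ H₂) ∧
    ((∀ t < P.T, (P.R t).PosDef) →
      ∃ G H₁ H₂, (∃ f : P.Strategy, TwoPlayerLQG.IsOptimal f N μ) ∧
        ∀ f : P.Strategy, TwoPlayerLQG.IsOptimal f N μ →
          TwoPlayerLQG.FiniteSecondMoments f N μ ∧ TwoPlayerLQG.HasForm f N μ G H₁ H₂) := by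
  obtain ⟨K, L, v, hL, hv, hg, hopt⟩ :=
    TwoPlayerLQG.LinNoise.exists_hasGains_optimal hcost hfinal hN.isWhite
  obtain ⟨f, hf, hfu, hfv⟩ := hN.exists_strategy hv
  have hJ : (TwoPlayerLQG.linNoise N μ).J (TwoPlayerLQG.ctrlL2 f N μ) = (TwoPlayerLQG.linNoise N μ).J v :=
    TwoPlayerLQG.costB_congr rfl (fun _ _ => rfl) hfv
  have hfc : TwoPlayerLQG.cost f N μ = ENNReal.ofReal ((TwoPlayerLQG.linNoise N μ).J v) := by
    rw [hN.cost_eq hcost hfinal hfu, hJ]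
  have hbest : ∀ g : P.Strategy, g.IsMeasurable → TwoPlayerLQG.FiniteSecondMoments g N μ →
      TwoPlayerLQG.cost f N μ ≤ TwoPlayerLQG.cost g N μ := fun g hgm hgu => by
    rw [hfc, hN.cost_eq hcost hfinal hgu]
    exact ENNReal.ofReal_le_ofReal (hopt _ (hN.isAdm_ctrlL2 hgm hgu))
  refine ⟨⟨_, _, _, f, ⟨hf, hfu, hbest⟩, hN.hasForm hv hg hL hf hfu hfv⟩, fun hR => ?_⟩
  refine ⟨fun t => (K t).submatrix Sum.inl id, fun t => (K t - L t).submatrix Sum.inr id,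
    fun t => (L t).submatrix Sum.inr id, ⟨f, hf, fun g hgm => ?_⟩, fun g hgo => ?_⟩
  · by_cases hc : TwoPlayerLQG.cost g N μ = ∞
    · exact hc ▸ le_top
    · exact hbest g hgm (hN.finiteSecondMoments_of_cost_ne_top hcost hfinal hR hgm hc)
  -- Comparison with `f` makes the cost finite, hence the controls square integrable; uniqueness
  -- then identifies them with `v` in `L²`, which fixes the gains.
  · have hle := hgo.2 f hf
    rw [hfc] at hle
    have hgu := hN.finiteSecondMoments_of_cost_ne_top hcost hfinal hR hgo.1
      (hle.trans_lt ENNReal.ofReal_lt_top).ne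
    rw [hN.cost_eq hcost hfinal hgu, ENNReal.ofReal_le_ofReal_iff
      (show 0 ≤ (TwoPlayerLQG.linNoise N μ).J v from
        TwoPlayerLQG.costB_nonneg hcost hfinal _)] at hle
    exact ⟨hgu, hN.hasForm hv hg hL hgo.1 hgu (TwoPlayerLQG.LinNoise.eq_of_optimal hcost hfinal hR hv.isAdm
      (hN.isAdm_ctrlL2 hgo.1 hgu) hopt hle)⟩
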